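/- Let $A\in\mathbb R^{m\times n}$ ($m\ge n\ge 1$) have full rank $n$ and rows $a_1,\dots,a_m$, let $p\ge 4$, $0<\varepsilon\le 1$, and put $\alpha=\frac{2}{p-2}\in(0,1]$, $\bar\alpha=\max\{1,\alpha\}$, $\beta=\frac1{1000}\min\{\alpha^2,1\}$. For $w\in\mathbb R^m_{>0}$ and $W=\mathrm{diag}(w)$ let $\sigma_i(w)=w_i\,a_i^\top(A^\top WA)^{-1}a_i$, $\rho_i(w)=\sigma_i(w)/w_i^{1+\alpha}$ and $\rho_{\max}(w)=\max_i\rho_i(w)$. Write $a\approx_\varepsilon b$ for $(1-\varepsilon)a\le b\le(1+\varepsilon)a$. The $\ell_p$ Lewis weights of $A$ are the unique vector $u\in\mathbb R^m_{\ge0}$ such that $A^\top U^{1-2/p}A$ is invertible, where $U=\mathrm{diag}(u)$, and $u_i^{2/p}=a_i^\top(A^\top U^{1-2/p}A)^{-1}a_i$ for all $i$. If $A$ has no zero row, then the function $F(w)=-\log\det(A^\top WA)+\frac1{1+\alpha}\sum_i w_i^{1+\alpha}$ has a unique minimizer $\overline w$ on $\mathbb R^m_{>0}$. The one-step algorithm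 starts with $w^{(0)}=(1,\dots,1)$ and performs only Descent steps $$w^{(k+1)}_i=w^{(k)}_i\Big[1+\eta^{(k)}_i\,\frac{\rho_i(w^{(k)})-1}{\rho_i(w^{(k)})+1}\Big]\quad(i=1,\dots,m),$$ with $\eta^{(k)}_i=\frac1{3\bar\alpha}$ if $\rho_i(w^{(k)})\ge1$ and $\eta^{(k)}_i=\frac{\beta}{3\bar\alpha}$ if $\rho_i(w^{(k)})<1$. After $T=\big\lceil c\,\alpha^{-3}\log(mp/\widetilde\varepsilon)\big\rceil$ iterations, where $\widetilde\varepsilon=\frac{\alpha^4\varepsilon^4}{(2m(\sqrt n+\alpha)(\alpha+\alpha^{-1}))^4}$, it returns $\widehat w_i=\big(a_i^\top(A^\top W^{(T)}A)^{-1}a_i\big)^{1/\alpha}$, $W^{(T)}=\mathrm{diag}(w^{(T)})$. Theorem. There are absolute constants $c$ and $C$ such that for all such $A,p,\varepsilon$ the following holds. 1. $T\le C\,p^3\log(mp/\varepsilon)$. 2. All iterates are positive and satisfy the rounding condition $\rho_{\max}(w^{(k)})\le1+\alpha$. 3. Each iteration uses $A$ only through the leverage scores $\sigma_i(w^{(k)})$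 of the rows of $DA$, for the diagonal matrix $D=\mathrm{diag}(w^{(k)})^{1/2}$. 4. The output gives $\varepsilon$-approximate Lewis weights: $\widehat w_i^{\,p/(p-2)}\approx_\varepsilon u_i$ for all $i$; and if $A$ has no zero row, then $\widehat w\in\mathbb R^m_{>0}$ and $\widehat w_i\approx_\varepsilon\overline w_i$ for all $i$. 5. The total runtime of the algorithm (together with the final entrywise power in 4), with $A^\top W^{(k)}A$ formed entry by entry and inverted by Gauss–Jordan elimination, on a machine with exact real numbers that charges one unit for each arithmetic operation, comparison, real power, logarithm, stored entry and pass of a loop, and $N+1$ units for rounding a number up to an integer $N$, is at most $C\,p^3mn^2\log(mp/\varepsilon)$. -/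

import Mathlib

/-! ### Leverage scores, Lewis weights and the convex objective -/

/-- The quadratic forms `aᵢᵀ (Aᵀ W A)⁻¹ aᵢ`, where `aᵢ` is the `i`-th row of `A` and
`W = diag w`. -/
noncomputable def rowForm {ι κ : Type} [Fintype ι] [DecidableEq ι] [Fintype κ] [DecidableEq κ]
    (A : Matrix ι κ ℝ) (w : ι → ℝ) (i : ι) : ℝ :=
  A i ⬝ᵥ ((A.transpose * Matrix.diagonal w * A)⁻¹).mulVec (A i)

/-- The leverage score `mᵢᵀ (Mᵀ M)⁻¹ mᵢ` of the `i`-th row of `M`. -/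
noncomputable def leverageScore {ι κ : Type} [Fintype ι] [Fintype κ] [DecidableEq κ]
    (M : Matrix ι κ ℝ) (i : ι) : ℝ :=
  M i ⬝ᵥ ((M.transpose * M)⁻¹).mulVec (M i)

/-- `σᵢ(w) = wᵢ aᵢᵀ (Aᵀ W A)⁻¹ aᵢ`. -/
noncomputable def sigma {ι κ : Type} [Fintype ι] [DecidableEq ι] [Fintype κ] [DecidableEq κ]
    (A : Matrix ι κ ℝ) (w : ι → ℝ) (i : ι) : ℝ :=
  w i * rowForm A w i

/-- `ρᵢ(w) = σᵢ(w) / wᵢ^(1+α)`. -/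
noncomputable def rho {ι κ : Type} [Fintype ι] [DecidableEq ι] [Fintype κ] [DecidableEq κ]
    (A : Matrix ι κ ℝ) (α : ℝ) (w : ι → ℝ) (i : ι) : ℝ :=
  sigma A w i / w i ^ (1 + α)

/-- `ρ_max(w) = maxᵢ ρᵢ(w)`. -/
noncomputable def rhoMax {ι κ : Type} [Fintype ι] [DecidableEq ι] [Fintype κ] [DecidableEq κ]
    (A : Matrix ι κ ℝ) (α : ℝ) (w : ι → ℝ) : ℝ :=
  ⨆ i, rho A α w i

/-- `u` is a vector of `ℓ_p` Lewis weights of `A`: a nonnegative vector for which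
`Aᵀ U^(1-2/p) A` is invertible and `uᵢ^(2/p) = aᵢᵀ (Aᵀ U^(1-2/p) A)⁻¹ aᵢ` for all `i`. -/
def IsLewisWeights {ι κ : Type} [Fintype ι] [DecidableEq ι] [Fintype κ] [DecidableEq κ]
    (p : ℝ) (A : Matrix ι κ ℝ) (u : ι → ℝ) : Prop :=
  (∀ i, 0 ≤ u i) ∧
  IsUnit (A.transpose * Matrix.diagonal (fun i => u i ^ (1 - 2 / p)) * A).det ∧
  ∀ i, u i ^ (2 / p) = rowForm A (fun j => u j ^ (1 - 2 / p)) i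

/-- `F(w) = - log det (Aᵀ W A) + (1/(1+α)) ∑ᵢ wᵢ^(1+α)`. -/
noncomputable def lewisObjective {ι κ : Type} [Fintype ι] [DecidableEq ι] [Fintype κ]
    [DecidableEq κ] (A : Matrix ι κ ℝ) (α : ℝ) (w : ι → ℝ) : ℝ :=
  - Real.log (A.transpose * Matrix.diagonal w * A).det + 1 / (1 + α) * ∑ i, w i ^ (1 + α)

/-- `v` is a minimizer of `F` over the positive orthant. -/
def IsObjectiveMinimizer {ι κ : Type} [Fintype ι] [DecidableEq ι] [Fintype κ] [DecidableEq κ]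
    (A : Matrix ι κ ℝ) (α : ℝ) (v : ι → ℝ) : Prop :=
  (∀ i, 0 < v i) ∧ ∀ w : ι → ℝ, (∀ i, 0 < w i) → lewisObjective A α v ≤ lewisObjective A α w

/-- `a ≈_ε b`, that is, `(1 - ε) a ≤ b ≤ (1 + ε) a`. -/
def ApproxEq (ε a b : ℝ) : Prop :=
  (1 - ε) * a ≤ b ∧ b ≤ (1 + ε) * a

/-! ### The one-step algorithm -/

/-- `α = 2/(p-2)`. -/
noncomputable def lewisAlpha (p : ℝ) : ℝ := 2 / (p - 2)

/-- `ᾱ = max {1, α}`. -/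
noncomputable def alphaBar (α : ℝ) : ℝ := max 1 α

/-- `β = min(α², 1)/1000`. -/
noncomputable def stepBeta (α : ℝ) : ℝ := 1 / 1000 * min (α ^ 2) 1

/-- The procedure `Descent(w, S, η)`: coordinates in `S` are multiplied by
`1 + ηᵢ (ρᵢ(w) - 1)/(ρᵢ(w) + 1)`, the others are kept. -/
noncomputable def descent {ι κ : Type} [Fintype ι] [DecidableEq ι] [Fintype κ] [DecidableEq κ]
    (A : Matrix ι κ ℝ) (α : ℝ) (w : ι → ℝ) (S : Finset ι) (η : ι → ℝ) (i : ι) : ℝ :=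
  if i ∈ S then w i * (1 + η i * ((rho A α w i - 1) / (rho A α w i + 1))) else w i

open Classical in
/-- The step sizes: `1/(3ᾱ)` where `ρᵢ(w) ≥ 1`, and `β/(3ᾱ)` where `ρᵢ(w) < 1`. -/
noncomputable def stepSize {ι κ : Type} [Fintype ι] [DecidableEq ι] [Fintype κ] [DecidableEq κ]
    (A : Matrix ι κ ℝ) (α : ℝ) (w : ι → ℝ) (i : ι) : ℝ :=
  if 1 ≤ rho A α w i then 1 / (3 * alphaBar α) else 1 / (3 * alphaBar α) * stepBeta α

/-- The iterates `w⁽ᵏ⁾`: start at the all-ones vector, then only `Descent` steps over all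
coordinates. -/
noncomputable def oneStepIterate {ι κ : Type} [Fintype ι] [DecidableEq ι] [Fintype κ]
    [DecidableEq κ] (A : Matrix ι κ ℝ) (p : ℝ) : ℕ → ι → ℝ
  | 0 => fun _ => 1
  | k + 1 =>
      descent A (lewisAlpha p) (oneStepIterate A p k) Finset.univ
        (stepSize A (lewisAlpha p) (oneStepIterate A p k))

/-- The target accuracy `ε̃ = α⁴ ε⁴ / (2 m (√n + α) (α + α⁻¹))⁴` for the objective. -/
noncomputable def objectiveAccuracy (m n : ℕ) (α ε : ℝ) : ℝ :=
  α ^ 4 * ε ^ 4 / (2 * m * (√(n : ℝ) + α) * (α + α⁻¹)) ^ 4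

open Classical in
/-- The number of iterations; `c` is the constant behind the `O` in its definition. -/
noncomputable def totalIterations (c m n : ℕ) (p ε : ℝ) : ℕ :=
  if lewisAlpha p ≤ 1 then
    ⌈c * (1 / lewisAlpha p ^ 3 *
      Real.log (m * p / objectiveAccuracy m n (lewisAlpha p) ε))⌉₊
  else
    ⌈c * (lewisAlpha p ^ 2 *
      Real.log (m * p / objectiveAccuracy m n (lewisAlpha p) ε))⌉₊

/-- The vector `ŵᵢ = (aᵢᵀ (Aᵀ W⁽ᵀ⁾ A)⁻¹ aᵢ)^(1/α)` returned after `T` iterations. -/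
noncomputable def oneStepOutput {ι κ : Type} [Fintype ι] [DecidableEq ι] [Fintype κ]
    [DecidableEq κ] (A : Matrix ι κ ℝ) (p : ℝ) (T : ℕ) (i : ι) : ℝ :=
  rowForm A (oneStepIterate A p T) i ^ (1 / lewisAlpha p)

/-! ### Cost model: a real-number machine that charges every elementary operation -/

/-- The result of a computation together with the number of elementary operations used. -/
structure Timed (β : Type) where
  val : β
  time : ℕ

instance : Monad Timed where
  pure x := ⟨x, 0⟩
  bind x f := ⟨(f x.val).val, x.time + (f x.val).time⟩

/-- The elementary operations on numbers that a program may use. Programs are written for an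
arbitrary type `R` of numbers, so that numbers can be produced and inspected only through these
operations. -/
structure Machine (R : Type) where
  lit : ℕ → Timed R
  add : R → R → Timed R
  sub : R → R → Timed R
  mul : R → R → Timed R
  div : R → R → Timed R
  pow : R → R → Timed R
  log : R → Timed R
  le : R → R → Timed Bool
  ceil : R → Timed ℕ

open Classical in
/-- The machine over the real numbers: every operation has unit cost, except that rounding
`x` up to an integer `N` (which only serves to set a loop bound) costs `N + 1`, the cost of
counting up to `N`. -/
noncomputable def realMachine : Machine ℝ where
  lit k := ⟨(k : ℝ), 1⟩
  add x y := ⟨x + y, 1⟩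
  sub x y := ⟨x - y, 1⟩
  mul x y := ⟨x * y, 1⟩
  div x y := ⟨x / y, 1⟩
  pow x y := ⟨x ^ y, 1⟩
  log x := ⟨Real.log x, 1⟩
  le x y := ⟨decide (x ≤ y), 1⟩
  ceil x := ⟨⌈x⌉₊, ⌈x⌉₊ + 1⟩

/-- Compute and store an array entry by entry; each entry costs its computation and one more
unit for the index handling and the storage. -/
def tabulate {β : Type} {m : ℕ} (f : Fin m → Timed β) : Timed (Fin m → β) :=
  ⟨fun i => (f i).val, ∑ i, ((f i).time + 1)⟩

/-- A loop that adds up `m` computed numbers. -/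
def sumLoop {R : Type} (M : Machine R) : (m : ℕ) → (Fin m → Timed R) → Timed R
  | 0, _ => M.lit 0
  | m + 1, f => do
      let s ← sumLoop M m (fun i => f i.castSucc)
      let x ← f (Fin.last m)
      M.add s x

/-- A loop `for k = 0, …, N - 1` over a state; each pass costs one unit of loop control. -/
def forLoop {β : Type} : (N : ℕ) → (Fin N → β → Timed β) → β → Timed β
  | 0, _, s => ⟨s, 0⟩
  | N + 1, f, s => do
      let s' ← forLoop N (fun k => f k.castSucc) s
      let s'' ← f (Fin.last N) s'
      ⟨s'', 1⟩

/-- The entries of `Aᵀ W A`. -/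
def gramProgram {R : Type} (M : Machine R) {m n : ℕ} (A : Fin m → Fin n → R) (w : Fin m → R) :
    Timed (Fin n → Fin n → R) :=
  tabulate fun i => tabulate fun j => sumLoop M m fun r => do
    let x ← M.mul (w r) (A r i)
    M.mul x (A r j)

/-- One step of in-place Gauss–Jordan inversion, with pivot `(k, k)`. -/
def pivotProgram {R : Type} (M : Machine R) {n : ℕ} (k : Fin n) (B : Fin n → Fin n → R) :
    Timed (Fin n → Fin n → R) :=
  tabulate fun i => tabulate fun j =>
    if i = k then
      if j = k then do
        let one ← M.lit 1
        M.div one (B k k)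
      else do
        let q ← M.div (B k j) (B k k)
        let zero ← M.lit 0
        M.sub zero q
    else
      if j = k then M.div (B i k) (B k k)
      else do
        let x ← M.mul (B i k) (B k j)
        let q ← M.div x (B k k)
        M.sub (B i j) q

/-- The quadratic forms `aᵢᵀ (Aᵀ W A)⁻¹ aᵢ` of all rows `aᵢ` of `A`. -/
def rowFormProgram {R : Type} (M : Machine R) {m n : ℕ} (A : Fin m → Fin n → R)
    (w : Fin m → R) : Timed (Fin m → R) := do
  let G ← gramProgram M A w
  let B ← forLoop n (fun k X => pivotProgram M k X) G
  tabulate fun r => sumLoop M n fun i => do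
    let s ← sumLoop M n fun j => M.mul (B i j) (A r j)
    M.mul (A r i) s

/-- One iteration: compute `ρ(w)`, the step sizes, and the next vector. The arguments `e`, `η₁`
and `η₂` hold `1 + α`, `1/(3ᾱ)` and `β/(3ᾱ)`. -/
def iterationProgram {R : Type} (M : Machine R) {m n : ℕ} (A : Fin m → Fin n → R)
    (e η₁ η₂ : R) (w : Fin m → R) : Timed (Fin m → R) := do
  let q ← rowFormProgram M A w
  tabulate fun i => do
    let s ← M.mul (w i) (q i)
    let d ← M.pow (w i) e
    let r ← M.div s d
    let one ← M.lit 1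
    let x ← M.sub r one
    let y ← M.add r one
    let z ← M.div x y
    let big ← M.le one r
    let h ← M.mul (if big then η₁ else η₂) z
    let f ← M.add one h
    M.mul (w i) f

/-- The number of iterations, computed from the input. The argument `α` holds `2/(p-2)`. -/
def countProgram {R : Type} (M : Machine R) (c m n : ℕ) (p ε α : R) : Timed ℕ := do
  let one ← M.lit 1
  let two ← M.lit 2
  let four ← M.lit 4
  let mR ← M.lit m
  let nR ← M.lit n
  let cR ← M.lit c
  let half ← M.div one two
  let root ← M.pow nR half
  let t₁ ← M.mul two mR
  let t₂ ← M.add root α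
  let t₃ ← M.mul t₁ t₂
  let inv ← M.div one α
  let t₄ ← M.add α inv
  let t₅ ← M.mul t₃ t₄
  let den ← M.pow t₅ four
  let α₄ ← M.pow α four
  let ε₄ ← M.pow ε four
  let num ← M.mul α₄ ε₄
  let acc ← M.div num den
  let mp ← M.mul mR p
  let arg ← M.div mp acc
  let l ← M.log arg
  let sq ← M.mul α α
  let small ← M.le α one
  if small then do
    let cube ← M.mul sq α
    let icube ← M.div one cube
    let x ← M.mul icube l
    let y ← M.mul cR x
    M.ceil y
  else do
    let x ← M.mul sq l
    let y ← M.mul cR x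
    M.ceil y

/-- The whole algorithm on the input `A`, `p`, `ε`. It returns the vector `ŵ` of the one-step
algorithm, and the vector with entries `ŵᵢ^(p/(p-2))`. -/
def oneStepProgram {R : Type} (M : Machine R) (c : ℕ) {m n : ℕ} (A : Fin m → Fin n → R)
    (p ε : R) : Timed ((Fin m → R) × (Fin m → R)) := do
  let one ← M.lit 1
  let two ← M.lit 2
  let three ← M.lit 3
  let thousand ← M.lit 1000
  let pm ← M.sub p two
  let α ← M.div two pm
  let e ← M.add one α
  let sq ← M.mul α α
  let small ← M.le α one
  let b ← M.div (if small then sq else one) thousand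
  let t ← M.mul three (if small then one else α)
  let η₁ ← M.div one t
  let η₂ ← M.mul η₁ b
  let T ← countProgram M c m n p ε α
  let w₀ ← tabulate fun _ : Fin m => M.lit 1
  let w ← forLoop T (fun _ x => iterationProgram M A e η₁ η₂ x) w₀
  let q ← rowFormProgram M A w
  let inv ← M.div one α
  let wHat ← tabulate fun i => M.pow (q i) inv
  let r ← M.div p pm
  let u ← tabulate fun i => M.pow (wHat i) r
  pure (wHat, u)

/-! Write `v` for the stationary weight (`v i ^ α = rowForm A v i` for all `i`) and `F` for the
objective; `p ≥ 4` means `α ≤ 1`. The proof plays two properties of `log det (Aᵀ W A)` against each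
other; both are read off in a basis diagonalizing two weighted Gram matrices at once.

Convexity in `log w` (`le_log_det_mul_sub`, Jensen) splits the effect of a full simultaneous step
into one-variable changes, so a step lowers `F` by at least `(α²/18000) ∑ wᵢ^(1+α) (ρᵢ - 1)²`.
Concavity in `w` (`log_det_sub_le`) bounds the whole gap `F(w) - F(v)` by `(2/α) ∑ wᵢ^(1+α) (ρᵢ -
1)²`. Hence every step contracts the gap by `1 - α³/36000`. Both estimates need `ρ ≤ 1 + α`. This
holds at the all-ones vector, where the `ρᵢ` are leverage scores, and it is preserved
(`rho_step_le`) because weights decrease only by a relative `O(α²)` per step, while a coordinate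
with `ρᵢ` near `1 + α` grows enough to compensate.

A small gap controls the Bregman divergences of `x^(1+α)/(1+α)` between the coordinates of `w` and
`v`, hence `∑ vᵢ^α |wᵢ - vᵢ|`. By Cauchy–Schwarz this sum bounds the relative error between the two
Gram matrices, and so between the quadratic forms (`IsStationaryWeight.rowForm_mem`). A relative
error `αε/4` there survives the final powers `1/α` and `p/2`. Working with stationary weights on the
closed orthant, rather than with minimizers on the open one, covers zero rows; Lewis weights are
their powers.

The program is followed operation by operation. Gauss–Jordan inversion is correct because each pivot
is a value of the positive definite form at a nonzero vector; `n ≤ m` absorbs its `n³` operations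
into `m n²`. -/

/-! ### Weighted Gram matrices -/

section LinearAlgebra

open Matrix

variable {ι κ : Type} [Fintype ι] [DecidableEq ι] [Fintype κ] [DecidableEq κ]

/-- The weighted Gram matrix `Aᵀ diag(w) A`. -/
abbrev weightedGram (A : Matrix ι κ ℝ) (w : ι → ℝ) : Matrix κ κ ℝ :=
  A.transpose * Matrix.diagonal w * A

omit [DecidableEq κ] in
theorem dotProduct_weightedGram_mulVec (A : Matrix ι κ ℝ) (w : ι → ℝ) (x : κ → ℝ) :
    x ⬝ᵥ (weightedGram A w *ᵥ x) = ∑ i, w i * (A i ⬝ᵥ x) ^ 2 := by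
  rw [weightedGram, ← mulVec_mulVec, ← mulVec_mulVec, dotProduct_mulVec, vecMul_transpose,
    dotProduct]
  refine Finset.sum_congr rfl fun i _ => ?_
  rw [mulVec_diagonal, mulVec]
  ring

omit [Fintype κ] [DecidableEq κ] in
theorem weightedGram_isHermitian (A : Matrix ι κ ℝ) (w : ι → ℝ) :
    (weightedGram A w).IsHermitian := by
  simp [weightedGram, IsHermitian, conjTranspose_eq_transpose_of_trivial, transpose_mul,
    Matrix.mul_assoc]

omit [DecidableEq κ] in
theorem weightedGram_posSemidef (A : Matrix ι κ ℝ) {w : ι → ℝ} (hw : ∀ i, 0 ≤ w i) :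
    (weightedGram A w).PosSemidef := by
  refine .of_dotProduct_mulVec_nonneg (weightedGram_isHermitian A w) fun x => ?_
  rw [star_trivial, dotProduct_weightedGram_mulVec]
  exact Finset.sum_nonneg fun i _ => mul_nonneg (hw i) (sq_nonneg _)

omit [DecidableEq κ] in
theorem weightedGram_posDef {A : Matrix ι κ ℝ} (hA : Function.Injective A.mulVec) {w : ι → ℝ}
    (hw : ∀ i, 0 < w i) : (weightedGram A w).PosDef := by
  have h := (PosDef.diagonal hw).conjTranspose_mul_mul_same hA
  rwa [conjTranspose_eq_transpose_of_trivial] at h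

omit [Fintype ι] [DecidableEq ι] [DecidableEq κ] in
theorem mulVec_injective_of_rank_eq {A : Matrix ι κ ℝ} (hA : A.rank = Fintype.card κ) :
    Function.Injective A.mulVec := by
  rw [mulVec_injective_iff, linearIndependent_iff_card_eq_finrank_span, ← hA,
    rank_eq_finrank_span_cols]
  rfl

theorem Matrix.PosDef.mulVec_inv_mulVec {G : Matrix κ κ ℝ} (hG : G.PosDef) (a : κ → ℝ) :
    G *ᵥ (G⁻¹ *ᵥ a) = a := by
  rw [mulVec_mulVec, mul_nonsing_inv _ ((isUnit_iff_isUnit_det G).1 hG.isUnit), one_mulVec]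

theorem Matrix.PosDef.dotProduct_inv_mulVec_nonneg {G : Matrix κ κ ℝ} (hG : G.PosDef)
    (a : κ → ℝ) : 0 ≤ a ⬝ᵥ (G⁻¹ *ᵥ a) :=
  hG.inv.posSemidef.dotProduct_mulVec_nonneg a

omit [DecidableEq κ] in
theorem dotProduct_mulVec_comm {G : Matrix κ κ ℝ} (hG : G.IsHermitian) (x y : κ → ℝ) :
    x ⬝ᵥ (G *ᵥ y) = y ⬝ᵥ (G *ᵥ x) := by
  have h : Gᵀ = G := by rw [← conjTranspose_eq_transpose_of_trivial]; exact hG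
  rw [dotProduct_mulVec, ← mulVec_transpose, h, dotProduct_comm]

/-- Cauchy–Schwarz for the dual norms given by `G` and `G⁻¹`. -/
theorem sq_dotProduct_le {G : Matrix κ κ ℝ} (hG : G.PosDef) (a x : κ → ℝ) :
    (a ⬝ᵥ x) ^ 2 ≤ (a ⬝ᵥ (G⁻¹ *ᵥ a)) * (x ⬝ᵥ (G *ᵥ x)) := by
  set y := G⁻¹ *ᵥ a with hy
  have hGy : G *ᵥ y = a := hG.mulVec_inv_mulVec a
  -- The quadratic form of `G` at `t • x - y` is nonnegative for all `t`; the claim is that its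
  -- discriminant is not positive.
  have key : ∀ t : ℝ, 0 ≤ (x ⬝ᵥ (G *ᵥ x)) * (t * t) + (-2 * (a ⬝ᵥ x)) * t + a ⬝ᵥ y := by
    intro t
    have h := hG.posSemidef.dotProduct_mulVec_nonneg (t • x - y)
    have e : (t • x - y) ⬝ᵥ (G *ᵥ (t • x - y)) =
        (x ⬝ᵥ (G *ᵥ x)) * (t * t) + (-2 * (a ⬝ᵥ x)) * t + a ⬝ᵥ y := by
      have h1 : y ⬝ᵥ (G *ᵥ x) = a ⬝ᵥ x := by
        rw [dotProduct_mulVec_comm hG.1, hGy, dotProduct_comm]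
      have h2 : x ⬝ᵥ a = a ⬝ᵥ x := dotProduct_comm _ _
      have h3 : y ⬝ᵥ a = a ⬝ᵥ y := dotProduct_comm _ _
      simp only [mulVec_sub, mulVec_smul, sub_dotProduct, dotProduct_sub, smul_dotProduct,
        dotProduct_smul, smul_eq_mul, hGy, h1, h2, h3]
      ring
    rw [star_trivial, e] at h
    exact h
  have h := discrim_le_zero key
  rw [discrim] at h
  nlinarith

theorem rowForm_nonneg {A : Matrix ι κ ℝ} {w : ι → ℝ} (hG : (weightedGram A w).PosDef) (i : ι) :
    0 ≤ rowForm A w i :=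
  hG.dotProduct_inv_mulVec_nonneg (A i)

theorem rowForm_pos {A : Matrix ι κ ℝ} {w : ι → ℝ} (hG : (weightedGram A w).PosDef) {i : ι}
    (hi : A i ≠ 0) : 0 < rowForm A w i := by
  have h := hG.inv.dotProduct_mulVec_pos hi
  rwa [star_trivial] at h

/-- `Gᵥ ≤ C G_w` in the Loewner order implies `aᵢᵀ G_w⁻¹ aᵢ ≤ C aᵢᵀ Gᵥ⁻¹ aᵢ`. -/
theorem rowForm_le_mul {A : Matrix ι κ ℝ} {v w : ι → ℝ} (hv : (weightedGram A v).PosDef)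
    (hw : (weightedGram A w).PosDef) {C : ℝ}
    (h : ∀ x, x ⬝ᵥ (weightedGram A v *ᵥ x) ≤ C * (x ⬝ᵥ (weightedGram A w *ᵥ x))) (i : ι) :
    rowForm A w i ≤ C * rowForm A v i := by
  -- Cauchy–Schwarz for `v`, tested at `y`, bounds the square of `rowForm A w i` by `rowForm A v i *
  -- (C * rowForm A w i)`; one factor cancels.
  set y := (weightedGram A w)⁻¹ *ᵥ A i with hy
  have hq : A i ⬝ᵥ y = rowForm A w i := rfl
  have h1 : y ⬝ᵥ (weightedGram A w *ᵥ y) = rowForm A w i := by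
    rw [hw.mulVec_inv_mulVec, dotProduct_comm, hq]
  have h2 := sq_dotProduct_le hv (A i) y
  have h3 : A i ⬝ᵥ ((weightedGram A v)⁻¹ *ᵥ A i) = rowForm A v i := rfl
  have h4 := h y
  rw [h1] at h4
  rw [hq, h3] at h2
  have h5 := rowForm_nonneg hv i
  have h6 := rowForm_nonneg hw i
  rcases h6.eq_or_lt with h0 | h0
  · have hA : A i = 0 := by
      by_contra hne
      exact (rowForm_pos hw hne).ne h0
    simp [rowForm, hA]
  · refine le_of_mul_le_mul_right ?_ h0
    calc rowForm A w i * rowForm A w i = rowForm A w i ^ 2 := by ring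
      _ ≤ rowForm A v i * (C * rowForm A w i) :=
        h2.trans (mul_le_mul_of_nonneg_left h4 h5)
      _ = _ := by ring

/-- For `y = G⁻¹ aᵢ` the number `q = yᵀ G y` is the sum of the nonnegative terms `wⱼ (aⱼ · y)²`, and
the `i`-th of them is `wᵢ q²`. -/
theorem mul_rowForm_le_one {A : Matrix ι κ ℝ} {w : ι → ℝ} (hw : ∀ i, 0 ≤ w i)
    (hG : (weightedGram A w).PosDef) (i : ι) : w i * rowForm A w i ≤ 1 := by
  set y := (weightedGram A w)⁻¹ *ᵥ A i with hy
  have hq : A i ⬝ᵥ y = rowForm A w i := rfl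
  have h1 : y ⬝ᵥ (weightedGram A w *ᵥ y) = rowForm A w i := by
    rw [hG.mulVec_inv_mulVec, dotProduct_comm, hq]
  rw [dotProduct_weightedGram_mulVec] at h1
  have h2 : w i * rowForm A w i ^ 2 ≤ rowForm A w i := by
    rw [← hq]
    nth_rewrite 2 [hq]
    rw [← h1]
    exact Finset.single_le_sum (f := fun j => w j * (A j ⬝ᵥ y) ^ 2)
      (fun j _ => mul_nonneg (hw j) (sq_nonneg _)) (Finset.mem_univ i)
  rcases (rowForm_nonneg hG i).eq_or_lt with h0 | h0
  · rw [← h0]; simp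
  · refine le_of_mul_le_mul_right ?_ h0
    linarith

/-- Simultaneous diagonalization of a positive definite and a symmetric matrix. -/
theorem exists_simultaneous_diagonalization {G H : Matrix κ κ ℝ} (hG : G.PosDef)
    (hH : H.IsHermitian) :
    ∃ (P : Matrix κ κ ℝ) (d : κ → ℝ), Pᵀ * G * P = 1 ∧ Pᵀ * H * P = diagonal d := by
  have diag : ∀ {M : Matrix κ κ ℝ} (hM : M.IsHermitian),
      ∃ U : Matrix κ κ ℝ, Uᵀ * U = 1 ∧ Uᵀ * M * U = diagonal hM.eigenvalues := by
    intro M hM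
    refine ⟨hM.eigenvectorUnitary, ?_, ?_⟩
    · have h := Unitary.coe_star_mul_self hM.eigenvectorUnitary
      rwa [star_eq_conjTranspose, conjTranspose_eq_transpose_of_trivial] at h
    · have h := hM.conjStarAlgAut_star_eigenvectorUnitary
      rw [Unitary.conjStarAlgAut_star_apply, star_eq_conjTranspose,
        conjTranspose_eq_transpose_of_trivial] at h
      exact h
  obtain ⟨U, -, hU⟩ := diag hG.1
  -- Rescaling the eigenvectors of `G` turns `G` into the identity. An orthogonal diagonalization of
  -- the transformed `H` then leaves the identity unchanged.
  set s : κ → ℝ := fun j => (√(hG.1.eigenvalues j))⁻¹ with hs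
  have hK : (U * diagonal s)ᵀ * G * (U * diagonal s) = 1 := by
    have e : (U * diagonal s)ᵀ * G * (U * diagonal s) =
        diagonal s * (Uᵀ * G * U) * diagonal s := by
      simp only [transpose_mul, diagonal_transpose, Matrix.mul_assoc]
    rw [e, hU, diagonal_mul_diagonal, diagonal_mul_diagonal, ← diagonal_one]
    congr 1
    funext j
    have hpos := hG.eigenvalues_pos j
    have h1 : √(hG.1.eigenvalues j) ≠ 0 := (Real.sqrt_pos.2 hpos).ne'
    have h2 := Real.mul_self_sqrt hpos.le
    simp only [hs]
    field_simp
    nlinarith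
  set K := U * diagonal s
  have hH' : (Kᵀ * H * K).IsHermitian := by
    have h := isHermitian_conjTranspose_mul_mul K hH
    rwa [conjTranspose_eq_transpose_of_trivial] at h
  obtain ⟨V, hV1, hV⟩ := diag hH'
  refine ⟨K * V, hH'.eigenvalues, ?_, ?_⟩
  · calc (K * V)ᵀ * G * (K * V) = Vᵀ * (Kᵀ * G * K) * V := by
          simp only [transpose_mul, Matrix.mul_assoc]
      _ = 1 := by rw [hK, Matrix.mul_one, hV1]
  · calc (K * V)ᵀ * H * (K * V) = Vᵀ * (Kᵀ * H * K) * V := by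
          simp only [transpose_mul, Matrix.mul_assoc]
      _ = _ := hV

/-- In a basis in which `Aᵀ W A` is the identity and `Aᵀ V A` is diagonal, with `E` the matrix `A`
in this basis, the determinants, the quadratic forms and the eigenvalues are explicit. -/
theorem exists_weightedGram_diagonalization {A : Matrix ι κ ℝ} {v w : ι → ℝ}
    (hw : (weightedGram A w).PosDef) (hv : (weightedGram A v).PosDef) :
    ∃ E : Matrix ι κ ℝ, (∀ j, ∑ i, w i * E i j ^ 2 = 1) ∧ (∀ j, 0 < ∑ i, v i * E i j ^ 2) ∧
      (∀ i, rowForm A w i = ∑ j, E i j ^ 2) ∧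
      Real.log (weightedGram A v).det - Real.log (weightedGram A w).det =
        ∑ j, Real.log (∑ i, v i * E i j ^ 2) := by
  obtain ⟨P, d, hP1, hP2⟩ := exists_simultaneous_diagonalization hw hv.1
  have hdet : P.det ^ 2 * (weightedGram A w).det = 1 := by
    have h := congrArg Matrix.det hP1
    rw [det_mul, det_mul, det_transpose, det_one] at h
    linarith
  have hP0 : P.det ≠ 0 := by
    rintro h0
    rw [h0] at hdet
    norm_num at hdet
  have hinv : (weightedGram A w)⁻¹ = P * Pᵀ := by
    refine inv_eq_left_inv ?_
    have h1 : Pᵀ * (weightedGram A w * P) = 1 := by rw [← Matrix.mul_assoc, hP1]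
    have h2 := mul_eq_one_comm.1 h1
    have h3 : P * Pᵀ * weightedGram A w * P = P := by
      rw [Matrix.mul_assoc, Matrix.mul_assoc, h1, Matrix.mul_one]
    have hu : IsUnit P.det := isUnit_iff_ne_zero.2 hP0
    calc P * Pᵀ * weightedGram A w = P * Pᵀ * weightedGram A w * (P * P⁻¹) := by
          rw [mul_nonsing_inv _ hu, Matrix.mul_one]
      _ = P * P⁻¹ := by rw [← Matrix.mul_assoc, h3]
      _ = 1 := mul_nonsing_inv _ hu
  have entry : ∀ (u : ι → ℝ) (j : κ),
      (Pᵀ * weightedGram A u * P) j j = ∑ i, u i * (A * P) i j ^ 2 := by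
    intro u j
    have e : Pᵀ * weightedGram A u * P = (A * P)ᵀ * (diagonal u * (A * P)) := by
      simp only [weightedGram, transpose_mul, Matrix.mul_assoc]
    rw [e, mul_apply]
    refine Finset.sum_congr rfl fun i _ => ?_
    rw [diagonal_mul, transpose_apply]
    ring
  have hd : ∀ j, d j = ∑ i, v i * (A * P) i j ^ 2 := by
    intro j
    rw [← entry, hP2, diagonal_apply_eq]
  have hdpos : ∀ j, 0 < d j := by
    have hPinj : Function.Injective P.mulVec := by
      rw [mulVec_injective_iff_isUnit, isUnit_iff_isUnit_det]
      exact isUnit_iff_ne_zero.2 hP0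
    have h := hv.conjTranspose_mul_mul_same hPinj
    rw [conjTranspose_eq_transpose_of_trivial, hP2] at h
    exact posDef_diagonal_iff.1 h
  refine ⟨A * P, fun j => ?_, fun j => ?_, fun i => ?_, ?_⟩
  · rw [← entry, hP1, one_apply_eq]
  · rw [← hd]; exact hdpos j
  · rw [rowForm, hinv, ← mulVec_mulVec, dotProduct_mulVec, ← mulVec_transpose, dotProduct]
    refine Finset.sum_congr rfl fun j _ => ?_
    have h : (Pᵀ *ᵥ A i) j = (A * P) i j := by
      rw [mulVec, mul_apply, dotProduct]
      exact Finset.sum_congr rfl fun k _ => mul_comm _ _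
    rw [h]; ring
  · have h2 : P.det ^ 2 * (weightedGram A v).det = ∏ j, d j := by
      have h := congrArg Matrix.det hP2
      rw [det_mul, det_mul, det_transpose, det_diagonal] at h
      linarith
    simp_rw [← hd]
    rw [← Real.log_prod (fun j _ => (hdpos j).ne'), ← h2,
      Real.log_mul (pow_ne_zero _ hP0) hv.det_pos.ne']
    have h3 := congrArg Real.log hdet
    rw [Real.log_mul (pow_ne_zero _ hP0) hw.det_pos.ne', Real.log_one] at h3
    linarith

/-- Concavity of `log det (Aᵀ W A)` in `w`. -/
theorem log_det_sub_le {A : Matrix ι κ ℝ} {v w : ι → ℝ} (hw : (weightedGram A w).PosDef)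
    (hv : (weightedGram A v).PosDef) :
    Real.log (weightedGram A v).det - Real.log (weightedGram A w).det ≤
      ∑ i, rowForm A w i * (v i - w i) := by
  obtain ⟨E, h1, h2, h3, h4⟩ := exists_weightedGram_diagonalization hw hv
  rw [h4]
  -- `log x ≤ x - 1` for each relative eigenvalue, with the `1` written as `∑ i, w i * E i j ^ 2`.
  calc ∑ j, Real.log (∑ i, v i * E i j ^ 2)
      ≤ ∑ j, (∑ i, v i * E i j ^ 2 - ∑ i, w i * E i j ^ 2) :=
        Finset.sum_le_sum fun j _ => by
          rw [h1 j]; exact Real.log_le_sub_one_of_pos (h2 j)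
    _ = ∑ j, ∑ i, (v i - w i) * E i j ^ 2 := by
        refine Finset.sum_congr rfl fun j _ => ?_
        rw [← Finset.sum_sub_distrib]
        exact Finset.sum_congr rfl fun i _ => by ring
    _ = ∑ i, rowForm A w i * (v i - w i) := by
        rw [Finset.sum_comm]
        refine Finset.sum_congr rfl fun i _ => ?_
        rw [h3, Finset.sum_mul]
        exact Finset.sum_congr rfl fun j _ => by ring

/-- Convexity of `log det (Aᵀ W A)` in `log w`. -/
theorem le_log_det_mul_sub {A : Matrix ι κ ℝ} (hA : Function.Injective A.mulVec) {w d : ι → ℝ}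
    (hw : ∀ i, 0 < w i) (hd : ∀ i, 0 < d i) :
    ∑ i, sigma A w i * Real.log (d i) ≤
      Real.log (weightedGram A fun i => w i * d i).det - Real.log (weightedGram A w).det := by
  obtain ⟨E, h1, h2, h3, h4⟩ := exists_weightedGram_diagonalization
    (weightedGram_posDef hA hw) (weightedGram_posDef hA fun i => mul_pos (hw i) (hd i))
  rw [h4]
  calc ∑ i, sigma A w i * Real.log (d i)
      = ∑ j, ∑ i, w i * E i j ^ 2 * Real.log (d i) := by
        rw [Finset.sum_comm]
        refine Finset.sum_congr rfl fun i _ => ?_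
        rw [sigma, h3, Finset.mul_sum, Finset.sum_mul]
    _ ≤ ∑ j, Real.log (∑ i, w i * d i * E i j ^ 2) := by
        refine Finset.sum_le_sum fun j _ => ?_
        -- Jensen's inequality: for fixed `j` the numbers `w i * E i j ^ 2` are probability weights.
        have h := strictConcaveOn_log_Ioi.concaveOn.le_map_sum (t := Finset.univ)
          (w := fun i => w i * E i j ^ 2) (p := d)
          (fun i _ => mul_nonneg (hw i).le (sq_nonneg _)) (h1 j) (fun i _ => hd i)
        simp only [smul_eq_mul] at h
        refine h.trans_eq (congrArg Real.log (Finset.sum_congr rfl fun i _ => by ring))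

/-- Changing one weight is a rank-one update, so the matrix determinant lemma applies. This makes
the objective explicit along a coordinate line. -/
theorem det_weightedGram_update {A : Matrix ι κ ℝ} {v : ι → ℝ} (hv : (weightedGram A v).PosDef)
    (i : ι) (y : ℝ) :
    (weightedGram A (Function.update v i y)).det =
      (weightedGram A v).det * (1 + (y - v i) * rowForm A v i) := by
  have e : weightedGram A (Function.update v i y) =
      weightedGram A v +
        replicateCol Unit ((y - v i) • A i) * replicateRow Unit (A i) := by
    ext a b
    rw [Matrix.add_apply, weightedGram, weightedGram, mul_apply, mul_apply, mul_apply,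
      ← sub_eq_iff_eq_add',
      ← Finset.sum_sub_distrib]
    simp only [mul_diagonal, transpose_apply]
    rw [Finset.sum_eq_single i]
    · simp; ring
    · intro j _ hj
      rw [Function.update_of_ne hj]; ring
    · simp
  rw [e, det_add_replicateCol_mul_replicateRow ((isUnit_iff_isUnit_det _).1 hv.isUnit), det_unique (n := Unit)]
  congr 1
  rw [Matrix.add_apply, one_apply_eq, Matrix.mul_assoc, ← replicateCol_mulVec,
    replicateRow_mul_replicateCol_apply, mulVec_smul, dotProduct_smul, smul_eq_mul]
  rfl

theorem sigma_eq_leverageScore (A : Matrix ι κ ℝ) {w : ι → ℝ} (hw : ∀ i, 0 ≤ w i) (i : ι) :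
    sigma A w i = leverageScore (Matrix.diagonal (fun j => √(w j)) * A) i := by
  have e : (diagonal (fun j => √(w j)) * A)ᵀ * (diagonal (fun j => √(w j)) * A) =
      weightedGram A w := by
    rw [transpose_mul, diagonal_transpose, Matrix.mul_assoc, ← Matrix.mul_assoc (diagonal _),
      diagonal_mul_diagonal, ← Matrix.mul_assoc]
    congr 3
    funext j
    exact Real.mul_self_sqrt (hw j)
  have r : (diagonal (fun j => √(w j)) * A) i = √(w i) • A i := by
    ext j
    simp [diagonal_mul]
  rw [leverageScore, e, r, mulVec_smul, smul_dotProduct, dotProduct_smul, smul_eq_mul, smul_eq_mul,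
    ← mul_assoc, Real.mul_self_sqrt (hw i)]
  rfl

end LinearAlgebra

/-! ### Scalar inequalities -/

section Scalar

/-- `log (1 + x) ≥ 1 - 1/(1 + x) = x - x²/(1 + x)`, and `1 + x ≥ 2/3`. -/
theorem sub_three_halves_sq_le_log_one_add {x : ℝ} (hx : -(1 / 3) ≤ x) :
    x - 3 / 2 * x ^ 2 ≤ Real.log (1 + x) := by
  have h0 : 0 < 1 + x := by linarith
  have h1 := Real.one_sub_inv_le_log_of_pos h0
  refine le_trans ?_ h1
  have e : 1 - (1 + x)⁻¹ = x - x ^ 2 / (1 + x) := by field_simp; ring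
  rw [e]
  have h2 : x ^ 2 / (1 + x) ≤ 3 / 2 * x ^ 2 := by
    rw [div_le_iff₀ h0]
    nlinarith [sq_nonneg x]
  linarith

theorem exp_le_one_add_two_mul {x : ℝ} (h0 : 0 ≤ x) (h1 : x ≤ 1) :
    Real.exp x ≤ 1 + 2 * x := by
  have h := (abs_le.1 (Real.abs_exp_sub_one_sub_id_le (abs_le.2 ⟨by linarith, h1⟩))).2
  nlinarith

/-- The change of one coordinate of the objective in a descent step. -/
theorem descent_scalar_le {α ρ δ : ℝ} (hα0 : 0 ≤ α) (hα1 : α ≤ 1) (hρ : 0 ≤ ρ)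
    (hδ0 : -(1 / 3) ≤ δ) :
    -ρ * Real.log (1 + δ) + ((1 + δ) ^ (1 + α) - 1) / (1 + α) ≤
      -(ρ - 1) * δ + 3 / 2 * (ρ + 1) * δ ^ 2 := by
  have h1 := mul_le_mul_of_nonneg_left (sub_three_halves_sq_le_log_one_add hδ0) hρ
  have h0 : 0 < 1 + δ := by linarith
  -- Bernoulli's inequality in its concave form; this is where `α ≤ 1` enters.
  have h2 : (1 + δ) ^ α ≤ 1 + α * δ := rpow_one_add_le_one_add_mul_self (by linarith) hα0 hα1
  have h3 : ((1 + δ) ^ (1 + α) - 1) / (1 + α) ≤ δ + δ ^ 2 := by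
    rw [div_le_iff₀ (by linarith), Real.rpow_add h0, Real.rpow_one]
    nlinarith [mul_le_mul_of_nonneg_left h2 h0.le, sq_nonneg δ, mul_nonneg hα0 (sq_nonneg δ)]
  nlinarith [sq_nonneg δ]

/-- The tangent line inequality for `x ^ (1 + α) / (1 + α)`. -/
theorem rpow_tangent_le {α x y : ℝ} (hα : 0 < α) (hx : 0 ≤ x) (hy : 0 ≤ y) :
    x ^ α * (y - x) ≤ (y ^ (1 + α) - x ^ (1 + α)) / (1 + α) := by
  have h1 : 0 < 1 + α := by linarith
  rw [le_div_iff₀ h1]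
  have hx1 : x ^ (1 + α) = x * x ^ α := by
    rw [Real.rpow_add' hx h1.ne', Real.rpow_one]
  have hpq : (1 + α).HolderConjugate ((1 + α) / α) :=
    (Real.holderConjugate_iff).2 ⟨by linarith, by field_simp⟩
  -- Young's inequality for `y * x ^ α` is the tangent inequality after clearing `1 + α`, and it
  -- also covers `x = 0`.
  have hyoung := Real.young_inequality_of_nonneg hy (Real.rpow_nonneg hx α) hpq
  have e : (x ^ α) ^ ((1 + α) / α) = x * x ^ α := by
    rw [← Real.rpow_mul hx, mul_div_cancel₀ _ hα.ne', hx1]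
  rw [e] at hyoung
  have e2 : y ^ (1 + α) / (1 + α) + x * x ^ α / ((1 + α) / α) =
      (y ^ (1 + α) + α * (x * x ^ α)) / (1 + α) := by
    field_simp
  rw [e2, le_div_iff₀ h1] at hyoung
  rw [hx1]
  linarith

/-- For `ρ ≥ 1`, `ρ^(1/α) ≤ exp ((ρ - 1)/α)`, and the rounding condition keeps this exponent at most
`1`, where `exp` has a linear bound. For `ρ ≤ 1` it is Bernoulli's inequality with exponent `1/α ≥
1`. -/
theorem abs_rpow_inv_sub_one_le {α ρ : ℝ} (hα0 : 0 < α) (hα1 : α ≤ 1) (hρ0 : 0 ≤ ρ)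
    (hρ1 : ρ ≤ 1 + α) : |ρ ^ (1 / α) - 1| ≤ 2 / α * |ρ - 1| := by
  have hinv : 1 ≤ 1 / α := by rw [le_div_iff₀ hα0]; linarith
  rcases le_total 1 ρ with h | h
  · have h1 : 1 ≤ ρ ^ (1 / α) := Real.one_le_rpow h (by linarith)
    rw [abs_of_nonneg (by linarith), abs_of_nonneg (by linarith)]
    have h2 : ρ ^ (1 / α) ≤ Real.exp ((ρ - 1) / α) := by
      have h3 : ρ ≤ Real.exp (ρ - 1) := by linarith [Real.add_one_le_exp (ρ - 1)]
      calc ρ ^ (1 / α) ≤ Real.exp (ρ - 1) ^ (1 / α) :=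
            Real.rpow_le_rpow hρ0 h3 (by linarith)
        _ = _ := by rw [← Real.exp_mul]; ring_nf
    have h4 := exp_le_one_add_two_mul (x := (ρ - 1) / α) (div_nonneg (by linarith) hα0.le)
      (by rw [div_le_one hα0]; linarith)
    have e : 2 / α * (ρ - 1) = 2 * ((ρ - 1) / α) := by ring
    linarith
  · have h1 : ρ ^ (1 / α) ≤ 1 := Real.rpow_le_one hρ0 h (by linarith)
    rw [abs_of_nonpos (by linarith), abs_of_nonpos (by linarith)]
    have h2 := one_add_mul_self_le_rpow_one_add (s := ρ - 1) (by linarith) hinv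
    rw [add_sub_cancel] at h2
    have h3 : 0 ≤ 1 / α * (1 - ρ) := mul_nonneg (by linarith) (by linarith)
    have e : 2 / α * -(ρ - 1) = 2 * (1 / α * (1 - ρ)) := by ring
    linarith

/-- The contribution of one coordinate to the suboptimality gap. -/
theorem gap_scalar_le {α ρ t : ℝ} (hα0 : 0 < α) (hα1 : α ≤ 1) (hρ0 : 0 ≤ ρ) (hρ1 : ρ ≤ 1 + α)
    (ht : 0 ≤ t) :
    ρ * (t - 1) - (t ^ (1 + α) - 1) / (1 + α) ≤ 2 / α * (ρ - 1) ^ 2 := by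
  -- `r` maximizes the left side over `t`. The tangent inequality at `r` replaces `t` by `r`, and
  -- the one at `1` then leaves `(ρ - 1) * (r - 1)`.
  set r := ρ ^ (1 / α) with hr
  have hr0 : 0 ≤ r := Real.rpow_nonneg hρ0 _
  have hrα : r ^ α = ρ := by
    rw [hr, ← Real.rpow_mul hρ0, one_div_mul_cancel hα0.ne', Real.rpow_one]
  have h1 := rpow_tangent_le hα0 hr0 ht
  have h2 := rpow_tangent_le hα0 zero_le_one hr0
  rw [Real.one_rpow, Real.one_rpow, one_mul] at h2
  rw [hrα] at h1
  have h3 := abs_rpow_inv_sub_one_le hα0 hα1 hρ0 hρ1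
  have h4 : (ρ - 1) * (r - 1) ≤ 2 / α * (ρ - 1) ^ 2 := by
    calc (ρ - 1) * (r - 1) ≤ |ρ - 1| * |r - 1| := by rw [← abs_mul]; exact le_abs_self _
      _ ≤ |ρ - 1| * (2 / α * |ρ - 1|) := mul_le_mul_of_nonneg_left h3 (abs_nonneg _)
      _ = 2 / α * |ρ - 1| ^ 2 := by ring
      _ = _ := by rw [sq_abs]
  rw [sub_div] at h1 h2 ⊢
  linarith

/-- The Bregman divergence from `1` is only barely superlinear for small `α`, so `(√t - 1)²`, which
grows linearly, replaces a quadratic lower bound. It comes from `t^(1+α) ≥ t + α t log t` and `t log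
t ≥ 2 (t - √t)`; dividing by `1 + α ≤ 2` costs the factor `1/2`. -/
theorem mul_sqrt_sub_one_sq_le {α t : ℝ} (hα0 : 0 < α) (hα1 : α ≤ 1) (ht : 0 ≤ t) :
    α / 2 * (√t - 1) ^ 2 ≤ (t ^ (1 + α) - 1) / (1 + α) - (t - 1) := by
  have h1 : 0 < 1 + α := by linarith
  rcases ht.eq_or_lt with rfl | ht
  · rw [Real.sqrt_zero, Real.zero_rpow h1.ne']
    have : (0 - 1) / (1 + α) - (0 - 1) = α / (1 + α) := by field_simp; ring
    rw [this, le_div_iff₀ h1]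
    nlinarith
  have hs : 0 < √t := Real.sqrt_pos.2 ht
  have hst : √t ^ 2 = t := Real.sq_sqrt ht.le
  have h2 : t + α * (t * Real.log t) ≤ t ^ (1 + α) := by
    have h := Real.add_one_le_exp (Real.log t * α)
    rw [Real.rpow_add ht, Real.rpow_one, Real.rpow_def_of_pos ht]
    nlinarith
  have h3 : 2 * (t - √t) ≤ t * Real.log t := by
    have h := Real.one_sub_inv_le_log_of_pos hs
    rw [Real.log_sqrt ht.le] at h
    have e : t * (1 - (√t)⁻¹) = t - √t := by
      nth_rewrite 1 [← hst]
      field_simp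
      nlinarith
    nlinarith [mul_le_mul_of_nonneg_left h ht.le]
  have h4 : α * (√t - 1) ^ 2 ≤ (t ^ (1 + α) - 1) - (1 + α) * (t - 1) := by
    have e : (√t - 1) ^ 2 = t - 2 * √t + 1 := by nlinarith
    rw [e]
    nlinarith
  have e2 : (t ^ (1 + α) - 1) / (1 + α) - (t - 1) =
      ((t ^ (1 + α) - 1) - (1 + α) * (t - 1)) / (1 + α) := by field_simp
  rw [e2, le_div_iff₀ h1]
  nlinarith [mul_nonneg hα0.le (sq_nonneg (√t - 1))]

/-- A small Bregman divergence of `x ^ (1 + α) / (1 + α)` forces closeness. -/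
theorem rpow_mul_abs_sub_le {α v w g : ℝ} (hα0 : 0 < α) (hα1 : α ≤ 1) (hv : 0 ≤ v)
    (hv1 : v ^ (1 + α) ≤ 1) (hw : 0 ≤ w)
    (hg : (w ^ (1 + α) - v ^ (1 + α)) / (1 + α) - v ^ α * (w - v) ≤ α / 2 * g ^ 2)
    (hg0 : 0 ≤ g) :
    v ^ α * |w - v| ≤ g ^ 2 + 2 * g := by
  rcases hv.eq_or_lt with rfl | hv
  · rw [Real.zero_rpow hα0.ne', zero_mul]; positivity
  -- By homogeneity the divergence is `s = v^(1+α)` times the divergence of `t` from `1`.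
  set t := w / v with ht
  have ht0 : 0 ≤ t := div_nonneg hw hv.le
  have hwt : w = v * t := by rw [ht]; field_simp
  set s := v ^ (1 + α) with hs
  have hs0 : 0 < s := Real.rpow_pos_of_pos hv _
  have hsv : s = v * v ^ α := by rw [hs, Real.rpow_add hv, Real.rpow_one]
  have e1 : (w ^ (1 + α) - s) / (1 + α) - v ^ α * (w - v) =
      s * ((t ^ (1 + α) - 1) / (1 + α) - (t - 1)) := by
    rw [hwt, Real.mul_rpow hv.le ht0, ← hs, mul_sub s, hsv]; ring
  have e2 : v ^ α * |w - v| = s * |t - 1| := by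
    have : w - v = v * (t - 1) := by rw [hwt]; ring
    rw [this, abs_mul, abs_of_pos hv, hsv]; ring
  rw [e1] at hg
  rw [e2]
  set z := |√t - 1| with hz
  have hz0 : 0 ≤ z := abs_nonneg _
  have h1 : s * z ^ 2 ≤ g ^ 2 := by
    have h := mul_le_mul_of_nonneg_left (mul_sqrt_sub_one_sq_le hα0 hα1 ht0) hs0.le
    rw [← sq_abs, ← hz] at h
    have h' : α / 2 * (s * z ^ 2) ≤ α / 2 * g ^ 2 := by linarith
    exact le_of_mul_le_mul_left h' (by positivity)
  -- Since `s ≤ 1`, `(s z)² ≤ s z² ≤ g²`.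
  have h2 : s * z ≤ g := by
    refine le_of_sq_le_sq ?_ hg0
    nlinarith [mul_nonneg hs0.le (sq_nonneg z)]
  have h3 : |t - 1| ≤ z * (z + 2) := by
    have e : t - 1 = (√t - 1) * (√t + 1) := by
      have := Real.sq_sqrt ht0
      nlinarith
    rw [e, abs_mul, ← hz, abs_of_nonneg (by positivity : 0 ≤ √t + 1)]
    refine mul_le_mul_of_nonneg_left ?_ hz0
    linarith [le_abs_self (√t - 1)]
  nlinarith [mul_le_mul_of_nonneg_left h3 hs0.le]

/-- Preservation of the rounding condition, for one coordinate: `f` is the factor by which the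
coordinate changes, and `b` bounds the decrease of every coordinate. -/
theorem rounding_scalar_le {α ρ f b : ℝ} (hα0 : 0 < α) (hα1 : α ≤ 1) (hρ1 : ρ ≤ 1 + α)
    (hb0 : 0 ≤ b) (hb : b ≤ α ^ 2 / 3000) (hf : 1 - b ≤ f)
    (hf1 : 1 ≤ ρ → 1 + 1 / 3 * ((ρ - 1) / (ρ + 1)) ≤ f) :
    ρ ≤ (1 + α) * (1 - b) * f ^ α := by
  have hα2 : α ^ 2 ≤ α := by nlinarith
  have hb1 : 0 < 1 - b := by linarith
  have hf0 : 0 < f := by linarith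
  -- Three regimes. For `ρ ≤ 1` the slack `1 + α` absorbs two factors `1 - b`. For `1 ≤ ρ ≤ 1 + α/2`
  -- the coordinate does not shrink and the slack `α/2` absorbs one. For larger `ρ` the growth gives
  -- `f^α ≥ 1 + α²/36`, which beats `b ≤ α²/3000`; hence the factor `α²` in the step size of
  -- decreasing coordinates.
  rcases le_total ρ 1 with h | h
  · have h1 : 1 - b ≤ f ^ α := by
      calc 1 - b ≤ (1 - b) ^ α := by
            nth_rewrite 1 [← Real.rpow_one (1 - b)]
            exact Real.rpow_le_rpow_of_exponent_ge hb1 (by linarith) hα1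
        _ ≤ f ^ α := Real.rpow_le_rpow hb1.le hf hα0.le
    have h2 : (1 + α) * (1 - b) * (1 - b) ≤ (1 + α) * (1 - b) * f ^ α :=
      mul_le_mul_of_nonneg_left h1 (by positivity)
    have h3 : 1 - α / 1500 ≤ (1 - b) * (1 - b) := by nlinarith
    have h4 : (1 + α) * (1 - α / 1500) ≤ (1 + α) * ((1 - b) * (1 - b)) :=
      mul_le_mul_of_nonneg_left h3 (by linarith)
    nlinarith
  · have hx : 0 ≤ 1 / 3 * ((ρ - 1) / (ρ + 1)) := by
      exact mul_nonneg (by norm_num) (div_nonneg (by linarith) (by linarith))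
    have hf2 := hf1 h
    rcases le_total ρ (1 + α / 2) with h' | h'
    · have h1 : 1 ≤ f ^ α := Real.one_le_rpow (by linarith) hα0.le
      have h2 : (1 + α) * (1 - b) * 1 ≤ (1 + α) * (1 - b) * f ^ α :=
        mul_le_mul_of_nonneg_left h1 (by positivity)
      nlinarith
    · have hx1 : α / 18 ≤ 1 / 3 * ((ρ - 1) / (ρ + 1)) := by
        have : α / 6 ≤ (ρ - 1) / (ρ + 1) := by
          rw [le_div_iff₀ (by linarith)]
          nlinarith
        linarith
      have hlog : α / 36 ≤ Real.log f := by
        have h1 : (1 + α / 18) ≤ f := by linarith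
        have h2 := sub_three_halves_sq_le_log_one_add (x := α / 18) (by linarith)
        have h3 := Real.log_le_log (by positivity) h1
        nlinarith
      have h1 : 1 + α ^ 2 / 36 ≤ f ^ α := by
        rw [Real.rpow_def_of_pos hf0]
        have h2 := Real.add_one_le_exp (Real.log f * α)
        nlinarith
      have h2 : (1 + α) * (1 - b) * (1 + α ^ 2 / 36) ≤ (1 + α) * (1 - b) * f ^ α :=
        mul_le_mul_of_nonneg_left h1 (by positivity)
      have h3 : 1 ≤ (1 - b) * (1 + α ^ 2 / 36) := by nlinarith
      nlinarith

/-- Relative errors of order `α ε` become `ε` after taking a power of order `1/α`. -/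
theorem approxEq_rpow {q r Δ e ε : ℝ} (hq : 0 ≤ q) (hr : 0 ≤ r) (hΔ0 : 0 ≤ Δ) (hΔ1 : Δ ≤ 1)
    (he : 1 ≤ e) (hε : ε ≤ 1) (hΔ : e * Δ ≤ ε / 2) (h1 : (1 - Δ) * q ≤ r)
    (h2 : r ≤ (1 + Δ) * q) : ApproxEq ε (q ^ e) (r ^ e) := by
  have hε0 : 0 ≤ ε := by nlinarith
  constructor
  · have h3 := one_add_mul_self_le_rpow_one_add (s := -Δ) (by linarith) he
    calc (1 - ε) * q ^ e ≤ (1 + -Δ) ^ e * q ^ e :=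
          mul_le_mul_of_nonneg_right (by linarith) (Real.rpow_nonneg hq _)
      _ = ((1 - Δ) * q) ^ e := by
          rw [Real.mul_rpow (by linarith) hq, sub_eq_add_neg]
      _ ≤ r ^ e := Real.rpow_le_rpow (mul_nonneg (by linarith) hq) h1 (by linarith)
  · have h3 : (1 + Δ) ^ e ≤ 1 + ε := by
      have h4 : 1 + Δ ≤ Real.exp Δ := by linarith [Real.add_one_le_exp Δ]
      calc (1 + Δ) ^ e ≤ Real.exp Δ ^ e :=
            Real.rpow_le_rpow (by linarith) h4 (by linarith)
        _ = Real.exp (e * Δ) := by rw [← Real.exp_mul, mul_comm]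
        _ ≤ 1 + 2 * (e * Δ) := exp_le_one_add_two_mul (by positivity) (by linarith)
        _ ≤ 1 + ε := by linarith
    calc r ^ e ≤ ((1 + Δ) * q) ^ e := Real.rpow_le_rpow hr h2 (by linarith)
      _ = (1 + Δ) ^ e * q ^ e := Real.mul_rpow (by linarith) hq
      _ ≤ (1 + ε) * q ^ e := mul_le_mul_of_nonneg_right h3 (Real.rpow_nonneg hq _)

end Scalar

/-! ### The minimizer of the objective and the Lewis weights -/

section Minimizer

open Matrix Filter Topology

variable {ι κ : Type} [Fintype ι] [DecidableEq ι] [Fintype κ] [DecidableEq κ]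

/-- First-order optimality for the objective on the closed orthant. -/
structure IsStationaryWeight (A : Matrix ι κ ℝ) (α : ℝ) (v : ι → ℝ) : Prop where
  nonneg : ∀ i, 0 ≤ v i
  posDef : (weightedGram A v).PosDef
  rpow_eq : ∀ i, v i ^ α = rowForm A v i

/-- `exp (-F)` becomes `det * exp (...)`, which is continuous on the whole compact box, even where
the determinant vanishes. It is positive at the all-ones vector, so a maximizer has a nonsingular
Gram matrix. -/
theorem exists_box_maximizer (A : Matrix ι κ ℝ) (hA : Function.Injective A.mulVec) {α : ℝ}
    (hα : 0 < α) :
    ∃ v : ι → ℝ, (∀ i, v i ∈ Set.Icc (0 : ℝ) 1) ∧ (weightedGram A v).PosDef ∧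
      ∀ w : ι → ℝ, (∀ i, w i ∈ Set.Icc (0 : ℝ) 1) → 0 < (weightedGram A w).det →
        lewisObjective A α v ≤ lewisObjective A α w := by
  set f : (ι → ℝ) → ℝ := fun w =>
    (weightedGram A w).det * Real.exp (-(1 / (1 + α) * ∑ i, w i ^ (1 + α))) with hf
  have hcont : Continuous f := by
    refine Continuous.mul ?_ (Real.continuous_exp.comp (Continuous.neg (continuous_const.mul
      (continuous_finsetSum _ fun i _ => ?_))))
    · refine Continuous.matrix_det ?_
      exact (continuous_const.matrix_mul continuous_id.matrix_diagonal).matrix_mul continuous_const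
    · exact (continuous_apply i).rpow_const fun _ => Or.inr (by linarith)
  obtain ⟨v, hvK, hmax⟩ := (isCompact_univ_pi fun _ : ι => isCompact_Icc).exists_isMaxOn
    (s := Set.univ.pi fun _ : ι => Set.Icc (0 : ℝ) 1) ⟨fun _ => 1, fun _ _ => by simp⟩
    hcont.continuousOn
  have hv01 : ∀ i, v i ∈ Set.Icc (0 : ℝ) 1 := fun i => hvK i trivial
  have hfv : 0 < f v := by
    have h1 : f (fun _ => 1) ≤ f v := hmax fun _ _ => by simp
    refine lt_of_lt_of_le (mul_pos ?_ (Real.exp_pos _)) h1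
    exact (weightedGram_posDef hA fun _ => one_pos).det_pos
  have hdet : 0 < (weightedGram A v).det := (mul_pos_iff_of_pos_right (Real.exp_pos _)).1 hfv
  refine ⟨v, hv01, ?_, fun w hw hw0 => ?_⟩
  · exact (weightedGram_posSemidef A fun i => (hv01 i).1).posDef_iff_det_ne_zero.2 hdet.ne'
  · have h1 : f w ≤ f v := hmax fun i _ => hw i
    have h2 := Real.log_le_log (mul_pos hw0 (Real.exp_pos _)) h1
    simp only [hf] at h2
    rw [Real.log_mul hw0.ne' (Real.exp_pos _).ne', Real.log_mul hdet.ne' (Real.exp_pos _).ne',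
      Real.log_exp, Real.log_exp] at h2
    unfold lewisObjective
    simp only [weightedGram] at h2
    linarith

theorem exists_isStationaryWeight (A : Matrix ι κ ℝ) (hA : Function.Injective A.mulVec) {α : ℝ}
    (hα : 0 < α) : ∃ v, IsStationaryWeight A α v := by
  obtain ⟨v, hv01, hG, hmin⟩ := exists_box_maximizer A hA hα
  refine ⟨v, fun i => (hv01 i).1, hG, fun i => ?_⟩
  set r := rowForm A v i with hr
  have hr0 : 0 ≤ r := rowForm_nonneg hG i
  -- Optimality along one coordinate, with the logarithm and the power bounded by tangents. Dividing
  -- by `y - v i` and letting `y` tend to `v i` from either side gives the two inequalities.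
  have key : ∀ y ∈ Set.Icc (0 : ℝ) 1, 0 < 1 + (y - v i) * r →
      (y - v i) * (r / (1 + (y - v i) * r)) ≤ (y - v i) * y ^ α := by
    intro y hy hpos
    have hdet := det_weightedGram_update hG i y
    have h1 := hmin (Function.update v i y)
      (fun j => by
        rcases eq_or_ne j i with rfl | hj
        · rwa [Function.update_self]
        · rw [Function.update_of_ne hj]; exact hv01 j)
      (by rw [hdet]; exact mul_pos hG.det_pos hpos)
    unfold lewisObjective at h1
    rw [hdet, Real.log_mul hG.det_pos.ne' hpos.ne', Finset.mul_sum, Finset.mul_sum,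
      ← Finset.add_sum_erase _ _ (Finset.mem_univ i),
      ← Finset.add_sum_erase _ (fun j => 1 / (1 + α) * Function.update v i y j ^ (1 + α))
        (Finset.mem_univ i), Function.update_self] at h1
    have h2 : ∑ j ∈ Finset.univ.erase i, 1 / (1 + α) * Function.update v i y j ^ (1 + α) =
        ∑ j ∈ Finset.univ.erase i, 1 / (1 + α) * v j ^ (1 + α) :=
      Finset.sum_congr rfl fun j hj => by rw [Function.update_of_ne (Finset.ne_of_mem_erase hj)]
    rw [h2] at h1
    have h3 := rpow_tangent_le hα hy.1 (hv01 i).1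
    have h4 := Real.one_sub_inv_le_log_of_pos hpos
    have h5 : 1 - (1 + (y - v i) * r)⁻¹ = (y - v i) * (r / (1 + (y - v i) * r)) := by
      field_simp; ring
    rw [h5] at h4
    have h6 : (v i ^ (1 + α) - y ^ (1 + α)) / (1 + α) =
        1 / (1 + α) * v i ^ (1 + α) - 1 / (1 + α) * y ^ (1 + α) := by ring
    rw [h6] at h3
    linarith
  have hc1 : ContinuousAt (fun y => r / (1 + (y - v i) * r)) (v i) :=
    ContinuousAt.div (by fun_prop) (by fun_prop) (by simp)
  have hc2 : ContinuousAt (fun y : ℝ => y ^ α) (v i) :=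
    Real.continuousAt_rpow_const _ _ (Or.inr hα.le)
  have hpos : ∀ᶠ y in 𝓝 (v i), 0 < 1 + (y - v i) * r := by
    have h : ContinuousAt (fun y => 1 + (y - v i) * r) (v i) := by fun_prop
    exact h.eventually (lt_mem_nhds (by simp))
  have ht1 : Tendsto (fun y => r / (1 + (y - v i) * r)) (𝓝 (v i)) (𝓝 r) := by
    have h := hc1.tendsto
    simpa using h
  -- At the ends of the box one side is unavailable: at `v i = 0` the first inequality is trivial,
  -- and at `v i = 1` the second says that a leverage score is at most `1`. So the artificial upper
  -- bound `1` never matters.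
  refine le_antisymm ?_ ?_
  · rcases (hv01 i).1.eq_or_lt with h0 | h0
    · rw [← h0, Real.zero_rpow hα.ne']; exact hr0
    · refine le_of_tendsto_of_tendsto (b := 𝓝[<] (v i)) (hc2.tendsto.mono_left nhdsWithin_le_nhds)
        (ht1.mono_left nhdsWithin_le_nhds) ?_
      filter_upwards [nhdsWithin_le_nhds hpos, nhdsWithin_le_nhds (lt_mem_nhds h0),
        self_mem_nhdsWithin] with y h1 h2 h3
      have h3 : y < v i := h3
      have h := key y ⟨h2.le, h3.le.trans (hv01 i).2⟩ h1
      exact (mul_le_mul_left_of_neg (by linarith)).1 h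
  · rcases (hv01 i).2.eq_or_lt with h1 | h1
    · have h := mul_rowForm_le_one (fun j => (hv01 j).1) hG i
      rw [h1, Real.one_rpow]
      rwa [h1, one_mul] at h
    · refine le_of_tendsto_of_tendsto (b := 𝓝[>] (v i)) (ht1.mono_left nhdsWithin_le_nhds)
        (hc2.tendsto.mono_left nhdsWithin_le_nhds) ?_
      filter_upwards [nhdsWithin_le_nhds hpos, nhdsWithin_le_nhds (gt_mem_nhds h1),
        self_mem_nhdsWithin] with y h2 h3 h4
      have h4 : v i < y := h4
      have h := key y ⟨(hv01 i).1.trans h4.le, le_of_lt h3⟩ h2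
      exact le_of_mul_le_mul_left h (by linarith)

/-! ### Stationary weights: optimality, uniqueness, and correspondence with Lewis weights. -/

namespace IsStationaryWeight

variable {A : Matrix ι κ ℝ} {α : ℝ} {v w : ι → ℝ}

theorem rpow_one_add_le_one (hv : IsStationaryWeight A α v) (hα : 0 < α) (i : ι) :
    v i ^ (1 + α) ≤ 1 := by
  rw [Real.rpow_add' (hv.nonneg i) (by linarith), Real.rpow_one, hv.rpow_eq]
  exact mul_rowForm_le_one hv.nonneg hv.posDef i

/-- The suboptimality gap dominates the Bregman divergences of the coordinates. -/
theorem sum_bregman_le (hv : IsStationaryWeight A α v) (hw : (weightedGram A w).PosDef) :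
    ∑ i, ((w i ^ (1 + α) - v i ^ (1 + α)) / (1 + α) - v i ^ α * (w i - v i)) ≤
      lewisObjective A α w - lewisObjective A α v := by
  -- By stationarity the gradient of `log det` at `v` is `v i ^ α`, exactly the linear term of the
  -- divergences.
  have h := log_det_sub_le hv.posDef hw
  simp only [← hv.rpow_eq] at h
  rw [Finset.sum_sub_distrib, ← Finset.sum_div, Finset.sum_sub_distrib]
  unfold lewisObjective
  simp only [weightedGram] at h
  rw [sub_div, div_eq_inv_mul, div_eq_inv_mul, one_div]
  linarith

theorem bregman_le (hv : IsStationaryWeight A α v) (hα : 0 < α) (hw0 : ∀ i, 0 ≤ w i)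
    (hw : (weightedGram A w).PosDef) (i : ι) :
    (w i ^ (1 + α) - v i ^ (1 + α)) / (1 + α) - v i ^ α * (w i - v i) ≤
      lewisObjective A α w - lewisObjective A α v :=
  (Finset.single_le_sum (f := fun i =>
    (w i ^ (1 + α) - v i ^ (1 + α)) / (1 + α) - v i ^ α * (w i - v i))
    (fun i _ => sub_nonneg.2 (rpow_tangent_le hα (hv.nonneg i) (hw0 i)))
    (Finset.mem_univ i)).trans (hv.sum_bregman_le hw)

theorem objective_le [Nonempty ι] (hv : IsStationaryWeight A α v) (hα : 0 < α)
    (hw0 : ∀ i, 0 ≤ w i) (hw : (weightedGram A w).PosDef) :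
    lewisObjective A α v ≤ lewisObjective A α w := by
  have i : ι := Classical.arbitrary ι
  have h1 := hv.bregman_le hα hw0 hw i
  have h2 := rpow_tangent_le hα (hv.nonneg i) (hw0 i)
  linarith

theorem eq_of_objective_le (hv : IsStationaryWeight A α v) (hα : 0 < α) (hα1 : α ≤ 1)
    (hw0 : ∀ i, 0 ≤ w i) (hw : (weightedGram A w).PosDef)
    (h : lewisObjective A α w ≤ lewisObjective A α v) : w = v := by
  funext i
  have h1 := hv.bregman_le hα hw0 hw i
  have h2 := rpow_mul_abs_sub_le hα hα1 (hv.nonneg i) (hv.rpow_one_add_le_one hα i) (hw0 i)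
    (g := 0) (by linarith) le_rfl
  -- Where `v i = 0` the weighted estimate `h2` is void, but there the divergence is `w i ^ (1 + α)
  -- / (1 + α)` itself.
  rcases (hv.nonneg i).eq_or_lt with h0 | h0
  · rw [← h0, Real.zero_rpow (by linarith), Real.zero_rpow hα.ne'] at h1
    rw [← h0]
    by_contra hne
    have h3 : 0 < w i := lt_of_le_of_ne (hw0 i) (Ne.symm hne)
    have h4 : 0 < w i ^ (1 + α) / (1 + α) :=
      div_pos (Real.rpow_pos_of_pos h3 _) (by linarith)
    rw [sub_zero, zero_mul, sub_zero] at h1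
    linarith
  · have h3 : 0 < v i ^ α := Real.rpow_pos_of_pos h0 _
    have h4 : |w i - v i| ≤ 0 := by
      by_contra! hpos
      have := mul_pos h3 hpos
      linarith
    linarith [abs_eq_zero.1 (le_antisymm h4 (abs_nonneg _))]

theorem unique [Nonempty ι] (hv : IsStationaryWeight A α v) (hw : IsStationaryWeight A α w)
    (hα : 0 < α) (hα1 : α ≤ 1) : w = v :=
  hv.eq_of_objective_le hα hα1 hw.nonneg hw.posDef (hw.objective_le hα hv.nonneg hv.posDef)

theorem pos (hv : IsStationaryWeight A α v) (hα : 0 < α) {i : ι} (hi : A i ≠ 0) : 0 < v i := by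
  refine lt_of_le_of_ne (hv.nonneg i) fun h0 => ?_
  have h := hv.rpow_eq i
  rw [← h0, Real.zero_rpow hα.ne'] at h
  exact (rowForm_pos hv.posDef hi).ne h

theorem eq_rowForm_rpow (hv : IsStationaryWeight A α v) (hα : 0 < α) (i : ι) :
    v i = rowForm A v i ^ (1 / α) := by
  rw [← hv.rpow_eq, ← Real.rpow_mul (hv.nonneg i), mul_one_div_cancel hα.ne', Real.rpow_one]

theorem isObjectiveMinimizer [Nonempty ι] (hv : IsStationaryWeight A α v)
    (hA : Function.Injective A.mulVec) (hα : 0 < α) (hrow : ∀ i, A i ≠ 0) :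
    IsObjectiveMinimizer A α v :=
  ⟨fun i => hv.pos hα (hrow i),
    fun _ hw => hv.objective_le hα (fun i => (hw i).le) (weightedGram_posDef hA hw)⟩

theorem eq_of_isObjectiveMinimizer (hv : IsStationaryWeight A α v)
    (hA : Function.Injective A.mulVec) (hα : 0 < α) (hα1 : α ≤ 1) (hrow : ∀ i, A i ≠ 0)
    (hw : IsObjectiveMinimizer A α w) : w = v :=
  hv.eq_of_objective_le hα hα1 (fun i => (hw.1 i).le) (weightedGram_posDef hA hw.1)
    (hw.2 v fun i => hv.pos hα (hrow i))

/-- With `u = v^(p/(p-2))` one has `u^(1-2/p) = v` and `u^(2/p) = v^α`, so the two systems of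
equations coincide. -/
theorem isLewisWeights {p : ℝ} (hp : 2 < p) (hv : IsStationaryWeight A (lewisAlpha p) v) :
    IsLewisWeights p A (fun i => v i ^ (p / (p - 2))) := by
  have hp2 : p - 2 ≠ 0 := by linarith
  have hp0 : p ≠ 0 := by linarith
  have e1 : (fun i => (v i ^ (p / (p - 2))) ^ (1 - 2 / p)) = v := by
    funext i
    rw [← Real.rpow_mul (hv.nonneg i)]
    have : p / (p - 2) * (1 - 2 / p) = 1 := by field_simp
    rw [this, Real.rpow_one]
  refine ⟨fun i => Real.rpow_nonneg (hv.nonneg i) _, ?_, fun i => ?_⟩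
  · rw [e1]
    exact (isUnit_iff_isUnit_det _).1 hv.posDef.isUnit
  · rw [e1, ← hv.rpow_eq, ← Real.rpow_mul (hv.nonneg i)]
    congr 1
    rw [lewisAlpha]
    field_simp

theorem _root_.IsLewisWeights.isStationaryWeight {p : ℝ} (hp : 2 < p) {u : ι → ℝ}
    (hu : IsLewisWeights p A u) :
    IsStationaryWeight A (lewisAlpha p) (fun i => u i ^ (1 - 2 / p)) := by
  obtain ⟨h0, h1, h2⟩ := hu
  have hp2 : p - 2 ≠ 0 := by linarith
  have hp0 : p ≠ 0 := by linarith
  have hnn : ∀ i, 0 ≤ u i ^ (1 - 2 / p) := fun i => Real.rpow_nonneg (h0 i) _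
  refine ⟨hnn, ?_, fun i => ?_⟩
  · exact (weightedGram_posSemidef A hnn).posDef_iff_isUnit.2 ((isUnit_iff_isUnit_det _).2 h1)
  · rw [← h2, ← Real.rpow_mul (h0 i)]
    congr 1
    rw [lewisAlpha]
    field_simp

theorem eq_of_isLewisWeights [Nonempty ι] {p : ℝ} (hp : 4 ≤ p)
    (hv : IsStationaryWeight A (lewisAlpha p) v) {u : ι → ℝ} (hu : IsLewisWeights p A u) :
    u = fun i => v i ^ (p / (p - 2)) := by
  have hα0 : 0 < lewisAlpha p := div_pos two_pos (by linarith)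
  have hα1 : lewisAlpha p ≤ 1 := (div_le_one (by linarith)).2 (by linarith)
  have h := hv.unique (hu.isStationaryWeight (by linarith)) hα0 hα1
  have hp2 : p - 2 ≠ 0 := by linarith
  have hp0 : p ≠ 0 := by linarith
  funext i
  rw [← h, ← Real.rpow_mul (hu.1 i)]
  have : (1 - 2 / p) * (p / (p - 2)) = 1 := by field_simp
  rw [this, Real.rpow_one]

end IsStationaryWeight

end Minimizer

/-! ### One descent step -/

section Descent

open Matrix

variable {ι κ : Type} [Fintype ι] [DecidableEq ι] [Fintype κ] [DecidableEq κ]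
  {A : Matrix ι κ ℝ} {α : ℝ} {w : ι → ℝ}

theorem sigma_eq_rho_mul (hw : ∀ i, 0 < w i) (i : ι) :
    sigma A w i = rho A α w i * w i ^ (1 + α) := by
  rw [rho, div_mul_cancel₀ _ (Real.rpow_pos_of_pos (hw i) _).ne']

theorem rowForm_eq_rho_mul (hw : ∀ i, 0 < w i) (i : ι) :
    rowForm A w i = rho A α w i * w i ^ α := by
  have h := sigma_eq_rho_mul (A := A) (α := α) hw i
  rw [sigma, Real.rpow_add (hw i), Real.rpow_one] at h
  exact mul_left_cancel₀ (hw i).ne' (by linarith)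

theorem rho_nonneg (hA : Function.Injective A.mulVec) (hw : ∀ i, 0 < w i) (i : ι) :
    0 ≤ rho A α w i :=
  div_nonneg (mul_nonneg (hw i).le (rowForm_nonneg (weightedGram_posDef hA hw) i))
    (Real.rpow_nonneg (hw i).le _)

theorem stepSize_mem (hα0 : 0 < α) (hα1 : α ≤ 1) (i : ι) :
    stepSize A α w i ∈ Set.Icc (α ^ 2 / 3000) (1 / 3) := by
  have h1 : alphaBar α = 1 := max_eq_left hα1
  have hα2 : α ^ 2 ≤ 1 := pow_le_one₀ hα0.le hα1
  have h2 : stepBeta α = α ^ 2 / 1000 := by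
    rw [stepBeta, min_eq_left hα2]; ring
  rw [stepSize, h1, h2]
  split_ifs <;> constructor <;> linarith

theorem stepSize_of_one_le (hα1 : α ≤ 1) {i : ι} (h : 1 ≤ rho A α w i) :
    stepSize A α w i = 1 / 3 := by
  have h1 : alphaBar α = 1 := max_eq_left hα1
  rw [stepSize, if_pos h, h1, mul_one]

theorem stepSize_of_lt_one (hα0 : 0 < α) (hα1 : α ≤ 1) {i : ι} (h : rho A α w i < 1) :
    stepSize A α w i = α ^ 2 / 3000 := by
  have h1 : alphaBar α = 1 := max_eq_left hα1
  rw [stepSize, if_neg (not_le.2 h), h1, stepBeta, min_eq_left (pow_le_one₀ hα0.le hα1)]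
  ring

/-- The relative change of a coordinate in a full descent step. -/
noncomputable def relativeStep (A : Matrix ι κ ℝ) (α : ℝ) (w : ι → ℝ) (i : ι) : ℝ :=
  stepSize A α w i * ((rho A α w i - 1) / (rho A α w i + 1))

theorem descent_univ_eq :
    descent A α w Finset.univ (stepSize A α w) = fun i => w i * (1 + relativeStep A α w i) := by
  funext i
  rw [descent, if_pos (Finset.mem_univ i), relativeStep]

theorem neg_le_relativeStep (hA : Function.Injective A.mulVec) (hα0 : 0 < α) (hα1 : α ≤ 1)
    (hw : ∀ i, 0 < w i) (i : ι) : -(α ^ 2 / 3000) ≤ relativeStep A α w i := by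
  have hρ := rho_nonneg (α := α) hA hw i
  rw [relativeStep]
  rcases le_or_gt 1 (rho A α w i) with h | h
  · rw [stepSize_of_one_le hα1 h]
    have : 0 ≤ 1 / 3 * ((rho A α w i - 1) / (rho A α w i + 1)) :=
      mul_nonneg (by norm_num) (div_nonneg (by linarith) (by linarith))
    linarith [sq_nonneg α]
  · rw [stepSize_of_lt_one hα0 hα1 h]
    have h1 : -1 ≤ (rho A α w i - 1) / (rho A α w i + 1) := by
      rw [le_div_iff₀ (by linarith)]; linarith
    nlinarith [sq_nonneg α]

theorem one_add_relativeStep_pos (hA : Function.Injective A.mulVec) (hα0 : 0 < α) (hα1 : α ≤ 1)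
    (hw : ∀ i, 0 < w i) (i : ι) : 0 < 1 + relativeStep A α w i := by
  have h := neg_le_relativeStep hA hα0 hα1 hw i
  nlinarith

/-- `ρᵢ = rowForm / wᵢ^α`. All weights keep at least the fraction `1 - b`, so the quadratic form
grows at most by `1/(1 - b)`, while the denominator gains the coordinate's own factor to the power
`α`. The scalar case analysis does the rest. -/
theorem rho_step_le (hA : Function.Injective A.mulVec) (hα0 : 0 < α) (hα1 : α ≤ 1)
    (hw : ∀ i, 0 < w i) (hρ : ∀ i, rho A α w i ≤ 1 + α) (i : ι) :
    rho A α (fun j => w j * (1 + relativeStep A α w j)) i ≤ 1 + α := by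
  set d : ι → ℝ := fun j => 1 + relativeStep A α w j with hd
  have hdpos : ∀ j, 0 < d j := fun j => one_add_relativeStep_pos hA hα0 hα1 hw j
  set w' : ι → ℝ := fun j => w j * d j with hw'
  have hw'pos : ∀ j, 0 < w' j := fun j => mul_pos (hw j) (hdpos j)
  set b := α ^ 2 / 3000 with hb
  have hb1 : 0 < 1 - b := by rw [hb]; nlinarith
  have hdb : ∀ j, 1 - b ≤ d j := fun j => by
    have := neg_le_relativeStep hA hα0 hα1 hw j
    simp only [hd]; linarith
  have hform : rowForm A w' i ≤ 1 / (1 - b) * rowForm A w i := by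
    refine rowForm_le_mul (weightedGram_posDef hA hw) (weightedGram_posDef hA hw'pos)
      (fun x => ?_) i
    rw [dotProduct_weightedGram_mulVec, dotProduct_weightedGram_mulVec, Finset.mul_sum]
    refine Finset.sum_le_sum fun j _ => ?_
    have h1 : w j ≤ 1 / (1 - b) * w' j := by
      rw [one_div, ← div_eq_inv_mul, le_div_iff₀ hb1]
      exact mul_le_mul_of_nonneg_left (hdb j) (hw j).le
    calc w j * (A j ⬝ᵥ x) ^ 2 ≤ 1 / (1 - b) * w' j * (A j ⬝ᵥ x) ^ 2 :=
          mul_le_mul_of_nonneg_right h1 (sq_nonneg _)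
      _ = _ := by ring
  rw [rowForm_eq_rho_mul (α := α) hw'pos, rowForm_eq_rho_mul (α := α) hw,
    Real.mul_rpow (hw i).le (hdpos i).le] at hform
  have hscal := rounding_scalar_le (f := d i) hα0 hα1 (hρ i) (by positivity) le_rfl (hdb i)
    (fun h => by simp only [hd, relativeStep]; rw [stepSize_of_one_le hα1 h])
  rw [← hb] at hscal
  have hwα : 0 < w i ^ α := Real.rpow_pos_of_pos (hw i) _
  have hdα : 0 < d i ^ α := Real.rpow_pos_of_pos (hdpos i) _
  have h2 : rho A α w' i * d i ^ α ≤ 1 / (1 - b) * rho A α w i := by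
    refine le_of_mul_le_mul_right ?_ hwα
    linarith
  have h3 : 1 / (1 - b) * rho A α w i ≤ (1 + α) * d i ^ α := by
    rw [one_div, ← div_eq_inv_mul, div_le_iff₀ hb1]
    linarith
  exact le_of_mul_le_mul_right (h2.trans h3) hdα

theorem objective_step_sub_le (hA : Function.Injective A.mulVec) (hα0 : 0 < α) (hα1 : α ≤ 1)
    (hw : ∀ i, 0 < w i) (hρ : ∀ i, rho A α w i ≤ 1 + α) :
    lewisObjective A α (fun j => w j * (1 + relativeStep A α w j)) - lewisObjective A α w ≤
      -(α ^ 2 / 18000) * ∑ i, w i ^ (1 + α) * (rho A α w i - 1) ^ 2 := by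
  have hdpos := one_add_relativeStep_pos hA hα0 hα1 hw
  have h1 := le_log_det_mul_sub hA hw hdpos
  have h2 : ∀ i, -(sigma A w i * Real.log (1 + relativeStep A α w i)) +
      1 / (1 + α) * ((w i * (1 + relativeStep A α w i)) ^ (1 + α) - w i ^ (1 + α)) ≤
      -(α ^ 2 / 18000) * (w i ^ (1 + α) * (rho A α w i - 1) ^ 2) := by
    intro i
    have hρ0 := rho_nonneg (α := α) hA hw i
    have hη := stepSize_mem (A := A) (w := w) hα0 hα1 i
    have hδ := neg_le_relativeStep hA hα0 hα1 hw i
    have hs := descent_scalar_le hα0.le hα1 hρ0 (δ := relativeStep A α w i) (by nlinarith)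
    have hbound : -(rho A α w i - 1) * relativeStep A α w i +
        3 / 2 * (rho A α w i + 1) * relativeStep A α w i ^ 2 ≤
        -(α ^ 2 / 18000) * (rho A α w i - 1) ^ 2 := by
      rw [relativeStep]
      set η := stepSize A α w i
      set ρ := rho A α w i
      have hρ3 : ρ + 1 ≤ 3 := by linarith [hρ i]
      have hρ1 : 0 < ρ + 1 := by linarith
      -- The denominator `ρ + 1` in the step makes the linear and quadratic terms multiples of the
      -- same expression. Then `α²/3000 ≤ η ≤ 1/3` and `ρ + 1 ≤ 3` give the constant `18000 = 6000 *
      -- 3`.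
      have e : -(ρ - 1) * (η * ((ρ - 1) / (ρ + 1))) +
          3 / 2 * (ρ + 1) * (η * ((ρ - 1) / (ρ + 1))) ^ 2 =
          -(η * (1 - 3 / 2 * η)) * ((ρ - 1) ^ 2 / (ρ + 1)) := by
        field_simp; ring
      have h3 : (ρ - 1) ^ 2 / 3 ≤ (ρ - 1) ^ 2 / (ρ + 1) :=
        div_le_div_of_nonneg_left (sq_nonneg _) hρ1 hρ3
      have h4 : α ^ 2 / 6000 ≤ η * (1 - 3 / 2 * η) := by
        obtain ⟨ha, hb⟩ := hη
        nlinarith [sq_nonneg α]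
      rw [e]
      have h5 := mul_le_mul h4 h3 (by positivity) (by nlinarith [sq_nonneg α])
      linarith
    have hw1 : 0 < w i ^ (1 + α) := Real.rpow_pos_of_pos (hw i) _
    have h3 := mul_le_mul_of_nonneg_left (hs.trans hbound) hw1.le
    rw [sigma_eq_rho_mul (α := α) hw, Real.mul_rpow (hw i).le (hdpos i).le]
    refine le_trans (le_of_eq ?_) (h3.trans (le_of_eq (by ring)))
    ring
  have h3 := Finset.sum_le_sum fun i (_ : i ∈ Finset.univ) => h2 i
  rw [Finset.sum_add_distrib, Finset.sum_neg_distrib, ← Finset.mul_sum, ← Finset.mul_sum,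
    Finset.sum_sub_distrib] at h3
  unfold lewisObjective
  simp only [weightedGram] at h1
  linarith

/-- Concavity of `log det` at `w` separates the gap into coordinates; each is the scalar estimate at
`t = v i / w i`, scaled by `w i ^ (1 + α)`. -/
theorem IsStationaryWeight.objective_sub_le {v : ι → ℝ} (hv : IsStationaryWeight A α v)
    (hA : Function.Injective A.mulVec) (hα0 : 0 < α) (hα1 : α ≤ 1) (hw : ∀ i, 0 < w i)
    (hρ : ∀ i, rho A α w i ≤ 1 + α) :
    lewisObjective A α w - lewisObjective A α v ≤
      2 / α * ∑ i, w i ^ (1 + α) * (rho A α w i - 1) ^ 2 := by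
  have h1 := log_det_sub_le (weightedGram_posDef hA hw) hv.posDef
  have h2 : ∀ i, rowForm A w i * (v i - w i) -
      1 / (1 + α) * (v i ^ (1 + α) - w i ^ (1 + α)) ≤
      2 / α * (w i ^ (1 + α) * (rho A α w i - 1) ^ 2) := by
    intro i
    have ht : 0 ≤ v i / w i := div_nonneg (hv.nonneg i) (hw i).le
    have hs := gap_scalar_le hα0 hα1 (rho_nonneg hA hw i) (hρ i) ht
    have hw1 : 0 < w i ^ (1 + α) := Real.rpow_pos_of_pos (hw i) _
    have h3 := mul_le_mul_of_nonneg_left hs hw1.le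
    refine le_trans (le_of_eq ?_) (h3.trans (le_of_eq (by ring)))
    rw [rowForm_eq_rho_mul (α := α) hw, Real.div_rpow (hv.nonneg i) (hw i).le]
    have hwi := (hw i).ne'
    have e : w i ^ (1 + α) = w i * w i ^ α := by rw [Real.rpow_add (hw i), Real.rpow_one]
    have e1 : w i ^ (1 + α) * (rho A α w i * (v i / w i - 1)) =
        rho A α w i * w i ^ α * (v i - w i) := by
      rw [e]; field_simp
    have e2 : w i ^ (1 + α) * ((v i ^ (1 + α) / w i ^ (1 + α) - 1) / (1 + α)) =
        1 / (1 + α) * (v i ^ (1 + α) - w i ^ (1 + α)) := by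
      field_simp
    rw [mul_sub (w i ^ (1 + α)), e1, e2]
  have h3 := Finset.sum_le_sum fun i (_ : i ∈ Finset.univ) => h2 i
  rw [Finset.sum_sub_distrib, ← Finset.mul_sum, ← Finset.mul_sum, Finset.sum_sub_distrib] at h3
  unfold lewisObjective
  simp only [weightedGram] at h1
  linarith

/-- Linear convergence: a step reduces the suboptimality gap by a constant factor. -/
theorem IsStationaryWeight.objective_step_sub_le {v : ι → ℝ} (hv : IsStationaryWeight A α v)
    (hA : Function.Injective A.mulVec) (hα0 : 0 < α) (hα1 : α ≤ 1) (hw : ∀ i, 0 < w i)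
    (hρ : ∀ i, rho A α w i ≤ 1 + α) :
    lewisObjective A α (fun j => w j * (1 + relativeStep A α w j)) - lewisObjective A α v ≤
      (1 - α ^ 3 / 36000) * (lewisObjective A α w - lewisObjective A α v) := by
  have h1 := _root_.objective_step_sub_le hA hα0 hα1 hw hρ
  have h2 := hv.objective_sub_le hA hα0 hα1 hw hρ
  -- `α³/36000` is the ratio of the constants `α²/18000` (decrease) and `2/α` (gap).
  have h3 := mul_le_mul_of_nonneg_left h2 (by positivity : 0 ≤ α ^ 3 / 36000)
  have e : ∀ S : ℝ, α ^ 3 / 36000 * (2 / α * S) = α ^ 2 / 18000 * S := by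
    intro S; field_simp; ring
  rw [e] at h3
  linarith

end Descent

/-! ### The iterates of the one-step algorithm -/

section Iterates

open Matrix

variable {ι κ : Type} [Fintype ι] [DecidableEq ι] [Fintype κ] [DecidableEq κ]
  {A : Matrix ι κ ℝ} {p : ℝ}

theorem lewisAlpha_pos (hp : 4 ≤ p) : 0 < lewisAlpha p := div_pos two_pos (by linarith)

theorem lewisAlpha_le_one (hp : 4 ≤ p) : lewisAlpha p ≤ 1 :=
  (div_le_one (by linarith)).2 (by linarith)

theorem oneStepIterate_succ (k : ℕ) :
    oneStepIterate A p (k + 1) = fun i => oneStepIterate A p k i *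
      (1 + relativeStep A (lewisAlpha p) (oneStepIterate A p k) i) :=
  descent_univ_eq

theorem rho_one_le_one (hA : Function.Injective A.mulVec) (α : ℝ) (i : ι) :
    rho A α (fun _ => 1) i ≤ 1 := by
  rw [rho, Real.one_rpow, div_one, sigma]
  exact mul_rowForm_le_one (fun _ => zero_le_one)
    (weightedGram_posDef hA fun _ => one_pos) i

theorem oneStepIterate_pos_and_rho_le (hA : Function.Injective A.mulVec) (hp : 4 ≤ p) (k : ℕ) :
    (∀ i, 0 < oneStepIterate A p k i) ∧
      ∀ i, rho A (lewisAlpha p) (oneStepIterate A p k) i ≤ 1 + lewisAlpha p := by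
  have hα0 := lewisAlpha_pos hp
  have hα1 := lewisAlpha_le_one hp
  induction k with
  | zero =>
    exact ⟨fun _ => one_pos, fun i => (rho_one_le_one hA _ i).trans (by linarith)⟩
  | succ k ih =>
    rw [oneStepIterate_succ]
    exact ⟨fun i => mul_pos (ih.1 i) (one_add_relativeStep_pos hA hα0 hα1 ih.1 i),
      rho_step_le hA hα0 hα1 ih.1 ih.2⟩

theorem IsStationaryWeight.objective_oneStepIterate_sub_le {v : ι → ℝ}
    (hv : IsStationaryWeight A (lewisAlpha p) v) (hA : Function.Injective A.mulVec) (hp : 4 ≤ p)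
    (k : ℕ) :
    lewisObjective A (lewisAlpha p) (oneStepIterate A p k) - lewisObjective A (lewisAlpha p) v ≤
      (1 - lewisAlpha p ^ 3 / 36000) ^ k * (2 / lewisAlpha p * Fintype.card ι) := by
  have hα0 := lewisAlpha_pos hp
  have hα1 := lewisAlpha_le_one hp
  induction k with
  | zero =>
    have hit := oneStepIterate_pos_and_rho_le hA hp 0
    rw [pow_zero, one_mul]
    refine (hv.objective_sub_le hA hα0 hα1 hit.1 hit.2).trans ?_
    refine mul_le_mul_of_nonneg_left ?_ (by positivity)
    -- At the all-ones vector each `ρᵢ` is a leverage score in `[0, 1]`, so each summand is at most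
    -- `1`.
    refine (Finset.sum_le_card_nsmul _ _ 1 fun i _ => ?_).trans_eq (by simp)
    have h0 := rho_nonneg (α := lewisAlpha p) hA hit.1 i
    have h1 := rho_one_le_one hA (lewisAlpha p) i
    change (1 : ℝ) ^ (1 + lewisAlpha p) * (rho A (lewisAlpha p) (fun _ => 1) i - 1) ^ 2 ≤ 1
    change 0 ≤ rho A (lewisAlpha p) (fun _ => 1) i at h0
    rw [Real.one_rpow]
    nlinarith
  | succ k ih =>
    have hit := oneStepIterate_pos_and_rho_le hA hp k
    have hc : 0 ≤ 1 - lewisAlpha p ^ 3 / 36000 := by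
      have : lewisAlpha p ^ 3 ≤ 1 := pow_le_one₀ hα0.le hα1
      linarith
    rw [oneStepIterate_succ]
    refine (hv.objective_step_sub_le hA hα0 hα1 hit.1 hit.2).trans ?_
    refine (mul_le_mul_of_nonneg_left ih hc).trans_eq ?_
    rw [pow_succ]; ring

/-- A point whose coordinates are close to the optimum, measured with the optimal leverage scores,
has quadratic forms close to the optimal ones. -/
theorem IsStationaryWeight.rowForm_mem {α : ℝ} {v w : ι → ℝ} (hv : IsStationaryWeight A α v)
    (hw : (weightedGram A w).PosDef) {Δ : ℝ} (hΔ : ∑ i, v i ^ α * |w i - v i| ≤ Δ) (i : ι) :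
    (1 - Δ) * rowForm A w i ≤ rowForm A v i ∧ rowForm A v i ≤ (1 + Δ) * rowForm A w i := by
  have hΔ0 : 0 ≤ Δ := le_trans (Finset.sum_nonneg fun j _ =>
    mul_nonneg (Real.rpow_nonneg (hv.nonneg j) _) (abs_nonneg _)) hΔ
  have key : ∀ x, |x ⬝ᵥ (weightedGram A w *ᵥ x) - x ⬝ᵥ (weightedGram A v *ᵥ x)| ≤
      Δ * (x ⬝ᵥ (weightedGram A v *ᵥ x)) := by
    intro x
    have hQ := hv.posDef.posSemidef.dotProduct_mulVec_nonneg x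
    rw [star_trivial] at hQ
    set Q := x ⬝ᵥ (weightedGram A v *ᵥ x) with hQdef
    calc |x ⬝ᵥ (weightedGram A w *ᵥ x) - Q|
        = |∑ j, (w j - v j) * (A j ⬝ᵥ x) ^ 2| := by
          rw [hQdef, dotProduct_weightedGram_mulVec, dotProduct_weightedGram_mulVec,
            ← Finset.sum_sub_distrib]
          congr 1
          exact Finset.sum_congr rfl fun j _ => by ring
      _ ≤ ∑ j, |(w j - v j) * (A j ⬝ᵥ x) ^ 2| := Finset.abs_sum_le_sum_abs _ _
      -- Cauchy–Schwarz and stationarity give `(aⱼ · x)² ≤ vⱼ^α Q`.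
      _ ≤ ∑ j, v j ^ α * |w j - v j| * Q := by
          refine Finset.sum_le_sum fun j _ => ?_
          rw [abs_mul, abs_of_nonneg (sq_nonneg (A j ⬝ᵥ x)), hv.rpow_eq]
          have h := sq_dotProduct_le hv.posDef (A j) x
          calc |w j - v j| * (A j ⬝ᵥ x) ^ 2 ≤ |w j - v j| * (rowForm A v j * Q) :=
                mul_le_mul_of_nonneg_left h (abs_nonneg _)
            _ = _ := by ring
      _ = (∑ j, v j ^ α * |w j - v j|) * Q := by rw [Finset.sum_mul]
      _ ≤ Δ * Q := mul_le_mul_of_nonneg_right hΔ hQ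
  constructor
  · rcases le_or_gt 1 Δ with h | h
    · exact (mul_nonpos_of_nonpos_of_nonneg (by linarith) (rowForm_nonneg hw i)).trans
        (rowForm_nonneg hv.posDef i)
    · have h1 : rowForm A w i ≤ 1 / (1 - Δ) * rowForm A v i := by
        refine rowForm_le_mul hv.posDef hw (fun x => ?_) i
        rw [one_div, ← div_eq_inv_mul, le_div_iff₀ (by linarith)]
        have := (abs_le.1 (key x)).1
        linarith
      rw [one_div, ← div_eq_inv_mul, le_div_iff₀ (by linarith)] at h1
      linarith
  · refine rowForm_le_mul hw hv.posDef (fun x => ?_) i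
    have := (abs_le.1 (key x)).2
    linarith

end Iterates

/-! ### The program: values and running times -/

section Program

open Matrix

@[simp] theorem Timed.bind_val {β γ : Type} (x : Timed β) (f : β → Timed γ) :
    (x >>= f).val = (f x.val).val := rfl

@[simp] theorem Timed.bind_time {β γ : Type} (x : Timed β) (f : β → Timed γ) :
    (x >>= f).time = x.time + (f x.val).time := rfl

@[simp] theorem Timed.pure_val {β : Type} (x : β) : (pure x : Timed β).val = x := rfl

@[simp] theorem Timed.pure_time {β : Type} (x : β) : (pure x : Timed β).time = 0 := rfl

section Machine

variable (x y : ℝ) (k : ℕ)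

@[simp] theorem realMachine_lit_val : (realMachine.lit k).val = k := rfl
@[simp] theorem realMachine_add_val : (realMachine.add x y).val = x + y := rfl
@[simp] theorem realMachine_sub_val : (realMachine.sub x y).val = x - y := rfl
@[simp] theorem realMachine_mul_val : (realMachine.mul x y).val = x * y := rfl
@[simp] theorem realMachine_div_val : (realMachine.div x y).val = x / y := rfl
@[simp] theorem realMachine_pow_val : (realMachine.pow x y).val = x ^ y := rfl
@[simp] theorem realMachine_log_val : (realMachine.log x).val = Real.log x := rfl
@[simp] theorem realMachine_le_val : ((realMachine.le x y).val = true) = (x ≤ y) := by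
  simp [realMachine]
@[simp] theorem realMachine_ceil_val : (realMachine.ceil x).val = ⌈x⌉₊ := rfl
@[simp] theorem realMachine_lit_time : (realMachine.lit k).time = 1 := rfl
@[simp] theorem realMachine_add_time : (realMachine.add x y).time = 1 := rfl
@[simp] theorem realMachine_sub_time : (realMachine.sub x y).time = 1 := rfl
@[simp] theorem realMachine_mul_time : (realMachine.mul x y).time = 1 := rfl
@[simp] theorem realMachine_div_time : (realMachine.div x y).time = 1 := rfl
@[simp] theorem realMachine_pow_time : (realMachine.pow x y).time = 1 := rfl
@[simp] theorem realMachine_log_time : (realMachine.log x).time = 1 := rfl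
@[simp] theorem realMachine_le_time : (realMachine.le x y).time = 1 := rfl
@[simp] theorem realMachine_ceil_time : (realMachine.ceil x).time = ⌈x⌉₊ + 1 := rfl

end Machine

@[simp] theorem tabulate_val {β : Type} {m : ℕ} (f : Fin m → Timed β) (i : Fin m) :
    (tabulate f).val i = (f i).val := rfl

theorem tabulate_time_le {β : Type} {m B : ℕ} {f : Fin m → Timed β} (h : ∀ i, (f i).time ≤ B) :
    (tabulate f).time ≤ m * (B + 1) := by
  have h1 := Finset.sum_le_card_nsmul Finset.univ (fun i => (f i).time + 1) (B + 1)
    fun i _ => Nat.succ_le_succ (h i)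
  rwa [Finset.card_univ, Fintype.card_fin, smul_eq_mul] at h1

@[simp] theorem sumLoop_val : ∀ {m : ℕ} (f : Fin m → Timed ℝ),
    (sumLoop realMachine m f).val = ∑ i, (f i).val
  | 0, _ => by simp [sumLoop]
  | m + 1, f => by
    rw [Fin.sum_univ_castSucc, ← sumLoop_val]
    rfl

theorem sumLoop_time_le {B : ℕ} : ∀ {m : ℕ} {f : Fin m → Timed ℝ}, (∀ i, (f i).time ≤ B) →
    (sumLoop realMachine m f).time ≤ 1 + m * (B + 1)
  | 0, _, _ => by simp [sumLoop]
  | m + 1, f, h => by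
    have h1 := sumLoop_time_le (f := fun i => f i.castSucc) fun i => h _
    have h2 : (sumLoop realMachine (m + 1) f).time =
      (sumLoop realMachine m fun i => f i.castSucc).time + ((f (Fin.last m)).time + 1) := rfl
    have h3 := h (Fin.last m)
    rw [h2]
    nlinarith

theorem forLoop_time_le {β : Type} {B : ℕ} : ∀ {N : ℕ} {f : Fin N → β → Timed β} {s : β},
    (∀ k x, (f k x).time ≤ B) → (forLoop N f s).time ≤ N * (B + 1)
  | 0, _, _, _ => by simp [forLoop]
  | N + 1, f, s, h => by
    have h1 := forLoop_time_le (f := fun k => f k.castSucc) (s := s) fun k => h _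
    have h2 : (forLoop (N + 1) f s).time = (forLoop N (fun k => f k.castSucc) s).time +
      ((f (Fin.last N) (forLoop N (fun k => f k.castSucc) s).val).time + 1) := rfl
    have h3 := h (Fin.last N) (forLoop N (fun k => f k.castSucc) s).val
    rw [h2]
    nlinarith

theorem forLoop_val_induction {β : Type} (P : ℕ → β → Prop) : ∀ {N : ℕ}
    {f : Fin N → β → Timed β} {s : β}, P 0 s →
    (∀ (k : Fin N) (x : β), P k x → P (k + 1) (f k x).val) → P N (forLoop N f s).val
  | 0, _, _, h0, _ => h0
  | _ + 1, _, _, h0, h =>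
    h (Fin.last _) _ (forLoop_val_induction P h0 fun k x hx => h k.castSucc x hx)

/-! ### Gram matrix, Gauss–Jordan inversion, iteration and iteration count. -/

variable {m n : ℕ}

theorem gramProgram_val (A : Matrix (Fin m) (Fin n) ℝ) (w : Fin m → ℝ) :
    (gramProgram realMachine (fun i j => A i j) w).val = weightedGram A w := by
  funext i j
  simp only [gramProgram, tabulate_val, sumLoop_val, weightedGram]
  rw [mul_apply]
  refine Finset.sum_congr rfl fun r _ => ?_
  rw [mul_diagonal, transpose_apply, mul_comm (A r i)]
  rfl

theorem gramProgram_time_le (A : Fin m → Fin n → ℝ) (w : Fin m → ℝ) :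
    (gramProgram realMachine A w).time ≤ n * (n * (1 + m * (2 + 1) + 1) + 1) :=
  tabulate_time_le fun _ => tabulate_time_le fun _ => sumLoop_time_le fun _ => le_rfl

theorem pivotProgram_val (k : Fin n) (B : Fin n → Fin n → ℝ) (i j : Fin n) :
    (pivotProgram realMachine k B).val i j =
      if i = k then (if j = k then 1 / B k k else -(B k j / B k k))
      else (if j = k then B i k / B k k else B i j - B i k * B k j / B k k) := by
  simp only [pivotProgram, tabulate_val]
  split_ifs <;> simp

theorem pivotProgram_time_le (k : Fin n) (B : Fin n → Fin n → ℝ) :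
    (pivotProgram realMachine k B).time ≤ n * (n * (3 + 1) + 1) := by
  refine tabulate_time_le fun i => tabulate_time_le fun j => ?_
  split_ifs <;> simp

/-- `X` arises from `G` by exchanging the first `k` coordinates of argument and value. -/
def IsPivotTransform (G : Matrix (Fin n) (Fin n) ℝ) (k : ℕ) (X : Fin n → Fin n → ℝ) : Prop :=
  ∀ z : Fin n → ℝ,
    G *ᵥ (fun j : Fin n => if (j : ℕ) < k then ∑ l, X j l * z l else z j) =
      fun j : Fin n => if (j : ℕ) < k then z j else ∑ l, X j l * z l

/-- Inserting the `k`-th unit vector gives `x` with `x k = 1`. For `j < k` the value `(G x) j` is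
zero and for `j > k` the argument `x j` is, so `xᵀ G x = X k k`. -/
theorem IsPivotTransform.pivot_pos {G : Matrix (Fin n) (Fin n) ℝ} (hG : G.PosDef) {k : Fin n}
    {X : Fin n → Fin n → ℝ} (hX : IsPivotTransform G k X) : 0 < X k k := by
  have h := hX (Pi.single k 1)
  have hs : ∀ j, ∑ l, X j l * (Pi.single k 1 : Fin n → ℝ) l = X j k := fun j => by
    simp [Pi.single_apply]
  simp only [hs] at h
  set x : Fin n → ℝ := fun j : Fin n => if (j : ℕ) < k then X j k else (Pi.single k 1 : Fin n → ℝ) j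
    with hx
  have hxk : x k = 1 := by simp [hx]
  have hx0 : x ≠ 0 := fun h0 => by rw [h0] at hxk; simp at hxk
  have hpos := hG.dotProduct_mulVec_pos hx0
  rw [star_trivial, h, dotProduct, Finset.sum_eq_single k] at hpos
  · simpa [hxk] using hpos
  · intro j _ hj
    by_cases hlt : (j : ℕ) < k
    · simp [hlt, hj]
    · have h0 : x j = 0 := by
        simp only [hx]
        rw [if_neg hlt, Pi.single_eq_of_ne hj]
      rw [h0, zero_mul]
  · simp

theorem IsPivotTransform.succ {G : Matrix (Fin n) (Fin n) ℝ} {k : Fin n}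
    {X : Fin n → Fin n → ℝ} (hX : IsPivotTransform G k X) (hk : X k k ≠ 0) :
    IsPivotTransform G (k + 1) (pivotProgram realMachine k X).val := by
  intro z
  set Y := (pivotProgram realMachine k X).val with hY
  have hsplit : ∀ f : Fin n → ℝ, ∑ l, f l = f k + ∑ l ∈ Finset.univ.erase k, f l := fun f =>
    (Finset.add_sum_erase _ _ (Finset.mem_univ k)).symm
  set R : Fin n → ℝ := fun i => ∑ l ∈ Finset.univ.erase k, X i l * z l with hR
  have hYk : ∑ l, Y k l * z l = (z k - R k) / X k k := by
    rw [hsplit, hY, pivotProgram_val, if_pos rfl, if_pos rfl]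
    have e : ∑ l ∈ Finset.univ.erase k, (pivotProgram realMachine k X).val k l * z l =
        ∑ l ∈ Finset.univ.erase k, -(1 / X k k) * (X k l * z l) := by
      refine Finset.sum_congr rfl fun l hl => ?_
      rw [pivotProgram_val, if_pos rfl, if_neg (Finset.ne_of_mem_erase hl)]
      ring
    rw [e, ← Finset.mul_sum]
    ring
  have hYi : ∀ i, i ≠ k →
      ∑ l, Y i l * z l = R i + X i k * ((z k - R k) / X k k) := by
    intro i hi
    rw [hsplit, hY, pivotProgram_val, if_neg hi, if_pos rfl]
    have e : ∑ l ∈ Finset.univ.erase k, (pivotProgram realMachine k X).val i l * z l =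
        ∑ l ∈ Finset.univ.erase k, (X i l * z l - X i k / X k k * (X k l * z l)) := by
      refine Finset.sum_congr rfl fun l hl => ?_
      rw [pivotProgram_val, if_neg hi, if_neg (Finset.ne_of_mem_erase hl)]
      ring
    rw [e, Finset.sum_sub_distrib, ← Finset.mul_sum]
    ring
  -- The pivot step solves the `k`-th equation for the `k`-th argument; feeding this solution to the
  -- old exchange relation gives the new one.
  have h := hX (Function.update z k ((z k - R k) / X k k))
  have hs : ∀ i, ∑ l, X i l * Function.update z k ((z k - R k) / X k k) l =
      R i + X i k * ((z k - R k) / X k k) := by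
    intro i
    rw [hsplit, Function.update_self, add_comm]
    congr 1
    refine Finset.sum_congr rfl fun l hl => ?_
    rw [Function.update_of_ne (Finset.ne_of_mem_erase hl)]
  have hsk : R k + X k k * ((z k - R k) / X k k) = z k := by
    rw [mul_div_cancel₀ _ hk]; ring
  simp only [hs] at h
  convert h using 2
  · funext j
    rcases eq_or_ne j k with rfl | hj
    · simp [hYk]
    · have hlt : (j : ℕ) < k + 1 ↔ (j : ℕ) < k := by
        have := Fin.val_ne_of_ne hj
        omega
      simp only [hlt, Function.update_of_ne hj, hYi j hj]
  · rename_i j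
    rcases eq_or_ne j k with rfl | hj
    · simp [hsk]
    · have hlt : (j : ℕ) < k + 1 ↔ (j : ℕ) < k := by
        have := Fin.val_ne_of_ne hj
        omega
      simp only [hlt, Function.update_of_ne hj, hYi j hj]

/-- The exchange relation is trivial for `k = 0`, and after all `n` exchanges it says `G X z = z`.
-/
theorem gaussJordan_val {G : Matrix (Fin n) (Fin n) ℝ} (hG : G.PosDef) :
    (forLoop n (fun k X => pivotProgram realMachine k X) fun i j => G i j).val = G⁻¹ := by
  have h : IsPivotTransform G n
      (forLoop n (fun k X => pivotProgram realMachine k X) fun i j => G i j).val := by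
    refine forLoop_val_induction (IsPivotTransform G) (fun z => ?_)
      fun k X hX => hX.succ (hX.pivot_pos hG).ne'
    simp only [Nat.not_lt_zero, if_false]
    rfl
  set X : Matrix (Fin n) (Fin n) ℝ :=
    (forLoop n (fun k X => pivotProgram realMachine k X) fun i j => G i j).val
  refine (inv_eq_right_inv ?_).symm
  refine Matrix.ext_of_mulVec_single fun i => ?_
  have hz := h (Pi.single i 1)
  simp only [Fin.is_lt, if_true] at hz
  rw [one_mulVec, ← mulVec_mulVec]
  exact hz

theorem rowFormProgram_val {A : Matrix (Fin m) (Fin n) ℝ} {w : Fin m → ℝ}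
    (hG : (weightedGram A w).PosDef) :
    (rowFormProgram realMachine (fun i j => A i j) w).val = rowForm A w := by
  funext r
  have h : (rowFormProgram realMachine (fun i j => A i j) w).val r =
      ∑ i, A r i * (sumLoop realMachine n fun j => realMachine.mul
        ((forLoop n (fun k X => pivotProgram realMachine k X)
          (gramProgram realMachine (fun i j => A i j) w).val).val i j) (A r j)).val := by
    simp only [rowFormProgram, Timed.bind_val, tabulate_val, sumLoop_val]
    rfl
  rw [h, gramProgram_val]
  have h2 := gaussJordan_val hG
  simp only [sumLoop_val]
  rw [h2]
  rfl

theorem rowFormProgram_time_le (hn : 1 ≤ n) (hmn : n ≤ m) (A : Fin m → Fin n → ℝ)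
    (w : Fin m → ℝ) : (rowFormProgram realMachine A w).time ≤ 19 * (m * n ^ 2) := by
  have h1 := gramProgram_time_le A w
  have h2 := forLoop_time_le (f := fun k X => pivotProgram realMachine k X)
    (s := (gramProgram realMachine A w).val) fun k X => pivotProgram_time_le (n := n) k X
  set B := forLoop n (fun k X => pivotProgram realMachine k X) (gramProgram realMachine A w).val
  have h3 : (tabulate fun r : Fin m => sumLoop realMachine n fun i => do
      let s ← sumLoop realMachine n fun j => realMachine.mul (B.val i j) (A r j)
      realMachine.mul (A r i) s).time ≤ m * (1 + n * (1 + n * (1 + 1) + 1 + 1) + 1) :=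
    tabulate_time_le fun r => sumLoop_time_le fun i => by
      have h := sumLoop_time_le (B := 1) (f := fun j => realMachine.mul (B.val i j) (A r j))
        fun _ => le_rfl
      exact Nat.add_le_add_right h 1
  refine (Nat.add_le_add h1 (Nat.add_le_add h2 h3)).trans ?_
  have a1 : n ^ 2 ≤ m * n ^ 2 := Nat.le_mul_of_pos_left _ (by omega)
  have a2 : n ≤ n ^ 2 := Nat.le_self_pow two_ne_zero n
  -- The cubic cost of the inversion is absorbed through `n ≤ m`.
  have a3 : n ^ 2 * n ≤ n ^ 2 * m := Nat.mul_le_mul_left _ hmn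
  have a4 : m * n ≤ m * n ^ 2 := Nat.mul_le_mul_left _ a2
  have a5 : m ≤ m * n := Nat.le_mul_of_pos_right _ (by omega)
  nlinarith

theorem iterationProgram_val {A : Matrix (Fin m) (Fin n) ℝ} {w : Fin m → ℝ} {α : ℝ}
    (hG : (weightedGram A w).PosDef) {η₁ η₂ : ℝ} (h₁ : η₁ = 1 / (3 * alphaBar α))
    (h₂ : η₂ = 1 / (3 * alphaBar α) * stepBeta α) :
    (iterationProgram realMachine (fun i j => A i j) (1 + α) η₁ η₂ w).val =
      descent A α w Finset.univ (stepSize A α w) := by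
  funext i
  simp only [iterationProgram, Timed.bind_val, tabulate_val, rowFormProgram_val hG, descent,
    stepSize, Finset.mem_univ, if_true, ← h₁, rho, sigma]
  by_cases h : 1 ≤ w i * rowForm A w i / w i ^ (1 + α)
  · simp [h]
  · simp [h, h₁, h₂]

theorem iterationProgram_time_le (hn : 1 ≤ n) (hmn : n ≤ m) (A : Fin m → Fin n → ℝ)
    (e η₁ η₂ : ℝ) (w : Fin m → ℝ) :
    (iterationProgram realMachine A e η₁ η₂ w).time ≤ 31 * (m * n ^ 2) := by
  have h1 := rowFormProgram_time_le hn hmn A w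
  have h2 : (iterationProgram realMachine A e η₁ η₂ w).time ≤
      (rowFormProgram realMachine A w).time + m * (11 + 1) :=
    Nat.add_le_add_left (tabulate_time_le fun _ => by simp) _
  have h3 : m ≤ m * n ^ 2 := Nat.le_mul_of_pos_right _ (by positivity)
  omega

theorem countProgram_val (c m n : ℕ) (p ε : ℝ) :
    (countProgram realMachine c m n p ε (lewisAlpha p)).val = totalIterations c m n p ε := by
  have h4 : ∀ x : ℝ, x ^ (4 : ℝ) = x ^ 4 := fun x => by
    rw [← Real.rpow_natCast]; norm_num
  unfold countProgram totalIterations objectiveAccuracy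
  by_cases h : lewisAlpha p ≤ 1
  · simp [h, h4, Real.sqrt_eq_rpow, pow_succ]
  · simp [h, h4, Real.sqrt_eq_rpow, pow_succ]

theorem countProgram_time_le (c m n : ℕ) (p ε : ℝ) :
    (countProgram realMachine c m n p ε (lewisAlpha p)).time ≤
      30 + totalIterations c m n p ε := by
  rw [← countProgram_val]
  unfold countProgram
  by_cases h : lewisAlpha p ≤ 1
  · simp [h, ← Nat.add_assoc]
  · simp [h, ← Nat.add_assoc]

theorem oneStepProgram_val {A : Matrix (Fin m) (Fin n) ℝ} (hA : Function.Injective A.mulVec)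
    {p : ℝ} (hp : 4 ≤ p) (c : ℕ) (ε : ℝ) :
    (oneStepProgram realMachine c (fun i j => A i j) p ε).val =
      (fun i => oneStepOutput A p (totalIterations c m n p ε) i,
        fun i => oneStepOutput A p (totalIterations c m n p ε) i ^ (p / (p - 2))) := by
  have hα1 := lewisAlpha_le_one hp
  have hα0 := lewisAlpha_pos hp
  have hα : (realMachine.div (realMachine.lit 2).val
      (realMachine.sub p (realMachine.lit 2).val).val).val = lewisAlpha p := by
    simp [lewisAlpha]
  have hbar : alphaBar (lewisAlpha p) = 1 := max_eq_left hα1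
  have hβ : stepBeta (lewisAlpha p) = lewisAlpha p * lewisAlpha p / 1000 := by
    rw [stepBeta, min_eq_left (pow_le_one₀ hα0.le hα1)]; ring
  have hG : ∀ k, (weightedGram A (oneStepIterate A p k)).PosDef := fun k =>
    weightedGram_posDef hA (oneStepIterate_pos_and_rho_le hA hp k).1
  have hloop : ∀ (T : ℕ) (η₁ η₂ : ℝ) (w₀ : Fin m → ℝ), w₀ = (fun _ => 1) →
      η₁ = 1 / (3 * alphaBar (lewisAlpha p)) →
      η₂ = 1 / (3 * alphaBar (lewisAlpha p)) * stepBeta (lewisAlpha p) →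
      (forLoop T (fun _ x => iterationProgram realMachine (fun i j => A i j)
        (1 + lewisAlpha p) η₁ η₂ x) w₀).val = oneStepIterate A p T := by
    intro T η₁ η₂ w₀ hw h₁ h₂
    refine forLoop_val_induction (fun k x => x = oneStepIterate A p k) hw fun k x hx => ?_
    rw [hx, iterationProgram_val (hG k) h₁ h₂]
    rfl
  simp only [oneStepProgram, Timed.bind_val, Timed.pure_val]
  rw [hα, countProgram_val]
  have he : (realMachine.add (realMachine.lit 1).val (lewisAlpha p)).val = 1 + lewisAlpha p := by
    simp
  rw [he, hloop _ _ _ _ (by funext i; simp) (by simp [hα1, hbar]) (by simp [hα1, hbar, hβ]),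
    rowFormProgram_val (hG _)]
  refine Prod.ext ?_ ?_
  · funext i; simp [oneStepOutput]
  · funext i; simp [oneStepOutput]

theorem oneStepProgram_time_le (hn : 1 ≤ n) (hmn : n ≤ m) (A : Fin m → Fin n → ℝ) (c : ℕ)
    (p ε : ℝ) :
    (oneStepProgram realMachine c A p ε).time ≤
      100 * ((totalIterations c m n p ε + 1) * (m * n ^ 2)) := by
  have hα : (realMachine.div (realMachine.lit 2).val
      (realMachine.sub p (realMachine.lit 2).val).val).val = lewisAlpha p := by
    simp [lewisAlpha]
  have h1 := countProgram_time_le c m n p ε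
  have h2 : ∀ (e η₁ η₂ : ℝ) (w₀ : Fin m → ℝ),
      (forLoop (totalIterations c m n p ε)
        (fun _ x => iterationProgram realMachine A e η₁ η₂ x) w₀).time ≤
        totalIterations c m n p ε * (31 * (m * n ^ 2) + 1) := fun e η₁ η₂ w₀ =>
    forLoop_time_le fun _ x => iterationProgram_time_le hn hmn A e η₁ η₂ x
  have h3 := rowFormProgram_time_le hn hmn A
  have h4 : (tabulate fun _ : Fin m => realMachine.lit 1).time ≤ m * (1 + 1) :=
    tabulate_time_le fun _ => le_rfl
  have h5 : ∀ (q : Fin m → ℝ) (x : ℝ), (tabulate fun i => realMachine.pow (q i) x).time ≤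
      m * (1 + 1) := fun q x => tabulate_time_le fun _ => le_rfl
  have h6 : m ≤ m * n ^ 2 := Nat.le_mul_of_pos_right _ (by positivity)
  simp only [oneStepProgram, Timed.bind_time, Timed.pure_time]
  rw [hα, countProgram_val]
  simp only [realMachine_lit_time, realMachine_add_time, realMachine_sub_time, realMachine_mul_time,
    realMachine_div_time, realMachine_le_time, ← Nat.add_assoc, Nat.reduceAdd, Nat.add_zero]
  set T := totalIterations c m n p ε
  set S := m * n ^ 2
  have e1 : 100 * ((T + 1) * S) = 100 * (T * S) + 100 * S := by ring
  have e2 : T * (31 * S + 1) = 31 * (T * S) + T := by ring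
  -- Loop control and the cost of rounding up to `T` are of order `T`.
  have h7 : T ≤ T * S := Nat.le_mul_of_pos_right _ (by omega)
  rw [e1]
  simp only [e2] at h2
  generalize T * S = TS at *
  refine (Nat.add_le_add (Nat.add_le_add_right (Nat.add_le_add (Nat.add_le_add_right
    (Nat.add_le_add (Nat.add_le_add (Nat.add_le_add (Nat.add_le_add_left h1 _) h4) (h2 _ _ _ _))
      (h3 _)) _) (h5 _ _)) _) (h5 _ _)).trans ?_
  omega

end Program

/-! ### Numerical bounds and the accuracy of the output -/

section Accuracy

open Matrix

theorem inv_lewisAlpha (p : ℝ) : (lewisAlpha p)⁻¹ = (p - 2) / 2 := by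
  rw [lewisAlpha, inv_div]

theorem objectiveAccuracy_pos {m n : ℕ} (hm : 0 < m) {α ε : ℝ} (hα : 0 < α) (hε : 0 < ε) :
    0 < objectiveAccuracy m n α ε := by
  rw [objectiveAccuracy]
  positivity

/-- Only `√n + α ≥ 1` and `α + α⁻¹ ≥ α⁻¹` are kept; this weaker bound is what the accuracy analysis
uses. -/
theorem objectiveAccuracy_le {m n : ℕ} (hm : 0 < m) (hn : 0 < n) {α ε : ℝ} (hα : 0 < α)
    (hε : 0 < ε) : objectiveAccuracy m n α ε ≤ (α ^ 2 * ε / (2 * m)) ^ 4 := by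
  have hm' : (0 : ℝ) < m := by exact_mod_cast hm
  have h1 : (1 : ℝ) ≤ √n := Real.one_le_sqrt.2 (by exact_mod_cast hn)
  have h2 : 2 * m * 1 * α⁻¹ ≤ 2 * m * (√(n : ℝ) + α) * (α + α⁻¹) :=
    mul_le_mul (mul_le_mul_of_nonneg_left (by linarith) (by positivity)) (by linarith)
      (by positivity) (by positivity)
  have h3 : objectiveAccuracy m n α ε = (α * ε / (2 * m * (√(n : ℝ) + α) * (α + α⁻¹))) ^ 4 := by
    rw [objectiveAccuracy, div_pow, mul_pow α ε]
  rw [h3]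
  refine pow_le_pow_left₀ (by positivity) ?_ 4
  calc α * ε / (2 * m * (√(n : ℝ) + α) * (α + α⁻¹)) ≤ α * ε / (2 * m * 1 * α⁻¹) :=
        div_le_div_of_nonneg_left (by positivity) (by positivity) h2
    _ = _ := by field_simp

theorem objectiveAccuracy_le_one {m n : ℕ} (hm : 0 < m) (hn : 0 < n) {α ε : ℝ} (hα : 0 < α)
    (hα1 : α ≤ 1) (hε : 0 < ε) (hε1 : ε ≤ 1) : objectiveAccuracy m n α ε ≤ 1 := by
  have hm' : (1 : ℝ) ≤ m := by exact_mod_cast hm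
  refine (objectiveAccuracy_le hm hn hα hε).trans (pow_le_one₀ (by positivity) ?_)
  rw [div_le_one (by positivity)]
  nlinarith [mul_le_mul (pow_le_one₀ hα.le hα1 : α ^ 2 ≤ 1) hε1 hε.le zero_le_one]

/-! ### Bounds for the logarithm and the iteration count. -/

section Logarithms

variable {m n : ℕ} {p ε : ℝ}

theorem one_le_log_div (hm : 0 < m) (hp : 4 ≤ p) (hε : 0 < ε) (hε1 : ε ≤ 1) :
    1 ≤ Real.log (m * p / ε) := by
  have hm' : (1 : ℝ) ≤ m := by exact_mod_cast hm
  rw [Real.le_log_iff_exp_le (by positivity), le_div_iff₀ hε]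
  have := Real.exp_one_lt_d9
  nlinarith [Real.exp_pos 1]

theorem log_div_objectiveAccuracy_nonneg (hm : 0 < m) (hn : 0 < n) (hp : 4 ≤ p) (hε : 0 < ε)
    (hε1 : ε ≤ 1) : 0 ≤ Real.log (m * p / objectiveAccuracy m n (lewisAlpha p) ε) := by
  have hα0 := lewisAlpha_pos hp
  have hm' : (1 : ℝ) ≤ m := by exact_mod_cast hm
  refine Real.log_nonneg ?_
  rw [le_div_iff₀ (objectiveAccuracy_pos hm hα0 hε)]
  have := objectiveAccuracy_le_one hm hn hα0 (lewisAlpha_le_one hp) hε hε1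
  nlinarith

theorem log_div_objectiveAccuracy_le (hm : 0 < m) (hmn : n ≤ m) (hp : 4 ≤ p) (hε : 0 < ε)
    (hε1 : ε ≤ 1) :
    Real.log (m * p / objectiveAccuracy m n (lewisAlpha p) ε) ≤
      17 * Real.log (m * p / ε) := by
  have hα0 := lewisAlpha_pos hp
  have hα1 := lewisAlpha_le_one hp
  have hinv := inv_lewisAlpha p
  set α := lewisAlpha p
  have hm' : (1 : ℝ) ≤ m := by exact_mod_cast hm
  have hn' : (n : ℝ) ≤ m := by exact_mod_cast hmn
  set X := m * p / ε with hX
  have hXmp : m * p ≤ X := by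
    rw [hX, le_div_iff₀ hε]
    have : 0 < m * p := by positivity
    nlinarith
  have hmp4 : p ≤ m * p := by nlinarith
  have hX4 : 4 ≤ X := by linarith
  have hsqrt : √(n : ℝ) ≤ m := by
    rw [Real.sqrt_le_left (by linarith)]
    nlinarith
  have hD : 2 * m * (√(n : ℝ) + α) * (α + α⁻¹) ≤ X ^ 2 := by
    have h1 : α + α⁻¹ ≤ p := by rw [hinv]; linarith
    calc 2 * m * (√(n : ℝ) + α) * (α + α⁻¹) ≤ 2 * m * (2 * m) * p := by
          refine mul_le_mul (mul_le_mul_of_nonneg_left (by linarith) (by positivity)) h1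
            (by positivity) (by positivity)
      _ = m * m * p * 4 := by ring
      _ ≤ m * m * p * p := mul_le_mul_of_nonneg_left hp (by positivity)
      _ = (m * p) ^ 2 := by ring
      _ ≤ X ^ 2 := pow_le_pow_left₀ (by positivity) hXmp 2
  have hiα : α⁻¹ ≤ X := by rw [hinv]; linarith
  have hiε : ε⁻¹ ≤ X := by
    rw [hX, div_eq_mul_inv]
    have : 0 < ε⁻¹ := inv_pos.2 hε
    nlinarith
  -- With `X = m p / ε`, the exponent is `17 = 1 + 8 + 4 + 4`, from `m p`, the fourth power of a
  -- denominator at most `X²`, `α⁻¹ ^ 4` and `ε⁻¹ ^ 4`.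
  have hbound : m * p / objectiveAccuracy m n α ε ≤ X ^ 17 := by
    have e : m * p / objectiveAccuracy m n α ε =
        m * p * (2 * m * (√(n : ℝ) + α) * (α + α⁻¹)) ^ 4 * α⁻¹ ^ 4 * ε⁻¹ ^ 4 := by
      rw [objectiveAccuracy, div_div_eq_mul_div, inv_pow, inv_pow]
      field_simp
    rw [e]
    calc m * p * (2 * m * (√(n : ℝ) + α) * (α + α⁻¹)) ^ 4 * α⁻¹ ^ 4 * ε⁻¹ ^ 4
        ≤ X * (X ^ 2) ^ 4 * X ^ 4 * X ^ 4 := by gcongr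
      _ = X ^ 17 := by ring
  have h := Real.log_le_log
    (div_pos (by positivity) (objectiveAccuracy_pos hm hα0 hε)) hbound
  rw [Real.log_pow] at h
  exact_mod_cast h

theorem totalIterations_add_one_le (c : ℕ) (hm : 0 < m) (hn : 0 < n) (hmn : n ≤ m) (hp : 4 ≤ p)
    (hε : 0 < ε) (hε1 : ε ≤ 1) :
    (totalIterations c m n p ε : ℝ) + 1 ≤ (3 * c + 2) * (p ^ 3 * Real.log (m * p / ε)) := by
  have hα0 := lewisAlpha_pos hp
  have hL0 := log_div_objectiveAccuracy_nonneg hm hn hp hε hε1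
  have hL1 := log_div_objectiveAccuracy_le hm hmn hp hε hε1
  have hl := one_le_log_div hm hp hε hε1
  rw [totalIterations, if_pos (lewisAlpha_le_one hp)]
  set L := Real.log (m * p / objectiveAccuracy m n (lewisAlpha p) ε)
  set l := Real.log (m * p / ε)
  have h1 : 1 / lewisAlpha p ^ 3 ≤ p ^ 3 / 8 := by
    rw [one_div, ← inv_pow, inv_lewisAlpha]
    have : ((p - 2) / 2) ^ 3 ≤ (p / 2) ^ 3 := pow_le_pow_left₀ (by linarith) (by linarith) 3
    calc _ ≤ _ := this
      _ = _ := by ring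
  -- `17/8 ≤ 3`.
  have h2 : 1 / lewisAlpha p ^ 3 * L ≤ 3 * (p ^ 3 * l) := by
    calc 1 / lewisAlpha p ^ 3 * L ≤ p ^ 3 / 8 * (17 * l) :=
          mul_le_mul h1 hL1 hL0 (by positivity)
      _ ≤ 3 * (p ^ 3 * l) := by
          have h : 0 ≤ p ^ 3 * l := mul_nonneg (by positivity) (by linarith)
          linarith
  have h3 := mul_le_mul_of_nonneg_left h2 (Nat.cast_nonneg (α := ℝ) c)
  have h4 : 1 ≤ p ^ 3 * l := by
    have : (1 : ℝ) ≤ p ^ 3 := one_le_pow₀ (by linarith)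
    nlinarith
  have h5 := Nat.ceil_lt_add_one (a := c * (1 / lewisAlpha p ^ 3 * L)) (by positivity)
  linarith

end Logarithms

variable {m n : ℕ} {A : Matrix (Fin m) (Fin n) ℝ} {p ε : ℝ} {v : Fin m → ℝ}

/-- The suboptimality gap after all iterations. -/
theorem IsStationaryWeight.objective_final_sub_le (hv : IsStationaryWeight A (lewisAlpha p) v)
    (hA : Function.Injective A.mulVec) (hm : 0 < m) (hn : 0 < n) (hp : 4 ≤ p) (hε : 0 < ε)
    (hε1 : ε ≤ 1) :
    lewisObjective A (lewisAlpha p)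
        (oneStepIterate A p (totalIterations 72000 m n p ε)) -
      lewisObjective A (lewisAlpha p) v ≤
      lewisAlpha p / 2 * (lewisAlpha p * ε / (12 * m)) ^ 2 := by
  have hα0 := lewisAlpha_pos hp
  have hα1 := lewisAlpha_le_one hp
  have hacc0 := objectiveAccuracy_pos (n := n) hm hα0 hε
  have hacc := objectiveAccuracy_le hm hn hα0 hε
  have hm' : (1 : ℝ) ≤ m := by exact_mod_cast hm
  refine (hv.objective_oneStepIterate_sub_le hA hp _).trans ?_
  have hT : 72000 * (1 / lewisAlpha p ^ 3 *
      Real.log (m * p / objectiveAccuracy m n (lewisAlpha p) ε)) ≤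
      totalIterations 72000 m n p ε := by
    rw [totalIterations, if_pos hα1]
    exact_mod_cast Nat.le_ceil _
  rw [Fintype.card_fin]
  set α := lewisAlpha p
  set T := totalIterations 72000 m n p ε
  set κ := objectiveAccuracy m n α ε
  have hα3 : α ^ 3 ≤ 1 := pow_le_one₀ hα0.le hα1
  -- The constant `72000 = 2 * 36000` produces the square, whose surplus powers of `y` and `1/m`
  -- absorb the initial gap `2m/α`.
  have hpow : (1 - α ^ 3 / 36000) ^ T ≤ (κ / (m * p)) ^ 2 := by
    calc (1 - α ^ 3 / 36000) ^ T ≤ Real.exp (-(α ^ 3 / 36000)) ^ T :=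
          pow_le_pow_left₀ (by linarith)
            (by linarith [Real.add_one_le_exp (-(α ^ 3 / 36000))]) T
      _ = Real.exp (-(α ^ 3 / 36000 * T)) := by rw [← Real.exp_nat_mul]; ring_nf
      _ ≤ Real.exp (2 * Real.log (κ / (m * p))) := by
          refine Real.exp_le_exp.2 ?_
          have e : Real.log (κ / (m * p)) = -Real.log (m * p / κ) := by
            rw [← Real.log_inv, inv_div]
          rw [e]
          have h := mul_le_mul_of_nonneg_left hT (by positivity : 0 ≤ α ^ 3 / 36000)
          have e2 : α ^ 3 / 36000 * (72000 * (1 / α ^ 3 * Real.log (m * p / κ))) =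
              2 * Real.log (m * p / κ) := by field_simp; ring
          linarith
      _ = (κ / (m * p)) ^ 2 := by
          have hpos : 0 < κ / (m * p) := by positivity
          rw [← Nat.cast_ofNat, ← Real.log_pow, Real.exp_log (pow_pos hpos 2)]
  set y := α ^ 2 * ε / (2 * m) with hy
  have hy0 : 0 < y := by positivity
  have hy1 : y ≤ 1 / 2 := by
    rw [hy, div_le_iff₀ (by positivity)]
    nlinarith [mul_le_mul (pow_le_one₀ hα0.le hα1 : α ^ 2 ≤ 1) hε1 hε.le zero_le_one]
  have hy6 : y ^ 6 ≤ 1 / 64 := by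
    calc y ^ 6 ≤ (1 / 2) ^ 6 := pow_le_pow_left₀ hy0.le hy1 6
      _ = 1 / 64 := by norm_num
  have hq : κ / (m * p) ≤ y ^ 4 / (4 * m) := by
    refine div_le_div₀ (by positivity) hacc (by positivity) ?_
    nlinarith
  have e : α / 2 * (α * ε / (12 * m)) ^ 2 = y ^ 2 / (72 * α) := by
    rw [hy]; field_simp; norm_num
  rw [e]
  calc (1 - α ^ 3 / 36000) ^ T * (2 / α * m)
      ≤ (y ^ 4 / (4 * m)) ^ 2 * (2 / α * m) :=
        mul_le_mul_of_nonneg_right (hpow.trans (pow_le_pow_left₀ (by positivity) hq 2))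
          (by positivity)
    _ = y ^ 2 / (72 * α) * (9 * y ^ 6 / m) := by field_simp; ring
    _ ≤ y ^ 2 / (72 * α) * 1 := by
        refine mul_le_mul_of_nonneg_left ?_ (by positivity)
        rw [div_le_one (by positivity)]
        linarith
    _ = _ := mul_one _

/-- The quadratic forms after all iterations are close to the optimal ones. -/
theorem IsStationaryWeight.rowForm_final_mem (hv : IsStationaryWeight A (lewisAlpha p) v)
    (hA : Function.Injective A.mulVec) (hm : 0 < m) (hn : 0 < n) (hp : 4 ≤ p) (hε : 0 < ε)
    (hε1 : ε ≤ 1) (i : Fin m) :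
    (1 - lewisAlpha p * ε / 4) *
        rowForm A (oneStepIterate A p (totalIterations 72000 m n p ε)) i ≤ rowForm A v i ∧
      rowForm A v i ≤ (1 + lewisAlpha p * ε / 4) *
        rowForm A (oneStepIterate A p (totalIterations 72000 m n p ε)) i := by
  have hα0 := lewisAlpha_pos hp
  have hα1 := lewisAlpha_le_one hp
  have hgap := hv.objective_final_sub_le hA hm hn hp hε hε1
  have hw := (oneStepIterate_pos_and_rho_le hA hp (totalIterations 72000 m n p ε)).1
  set w := oneStepIterate A p (totalIterations 72000 m n p ε)
  have hG := weightedGram_posDef hA hw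
  have hm' : (1 : ℝ) ≤ m := by exact_mod_cast hm
  refine hv.rowForm_mem hG ?_ i
  -- Each coordinate contributes at most `g² + 2g ≤ 3g`, and `m * 3g = αε/4`.
  set g := lewisAlpha p * ε / (12 * m) with hg
  have hg0 : 0 ≤ g := by positivity
  have hg1 : g ≤ 1 := by
    rw [hg, div_le_one (by positivity)]
    nlinarith
  have hcoord : ∀ j, v j ^ lewisAlpha p * |w j - v j| ≤ 3 * g := by
    intro j
    have h := rpow_mul_abs_sub_le hα0 hα1 (hv.nonneg j) (hv.rpow_one_add_le_one hα0 j) (hw j).le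
      ((hv.bregman_le hα0 (fun j => (hw j).le) hG j).trans hgap) hg0
    nlinarith
  refine (Finset.sum_le_card_nsmul _ _ _ fun j _ => hcoord j).trans_eq ?_
  rw [Finset.card_univ, Fintype.card_fin, nsmul_eq_mul, hg]
  field_simp
  norm_num

theorem IsStationaryWeight.approxEq_oneStepOutput (hv : IsStationaryWeight A (lewisAlpha p) v)
    (hA : Function.Injective A.mulVec) (hm : 0 < m) (hn : 0 < n) (hp : 4 ≤ p) (hε : 0 < ε)
    (hε1 : ε ≤ 1) (i : Fin m) :
    ApproxEq ε (oneStepOutput A p (totalIterations 72000 m n p ε) i) (v i) := by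
  have hα0 := lewisAlpha_pos hp
  have hα1 := lewisAlpha_le_one hp
  have h := hv.rowForm_final_mem hA hm hn hp hε hε1 i
  have hw := (oneStepIterate_pos_and_rho_le hA hp (totalIterations 72000 m n p ε)).1
  rw [hv.eq_rowForm_rpow hα0]
  refine approxEq_rpow (rowForm_nonneg (weightedGram_posDef hA hw) i)
    (rowForm_nonneg hv.posDef i) (by positivity) (by nlinarith) ?_ hε1 ?_ h.1 h.2
  · rw [le_div_iff₀ hα0]; linarith
  · have e : 1 / lewisAlpha p * (lewisAlpha p * ε / 4) = ε / 4 := by field_simp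
    linarith

theorem IsStationaryWeight.approxEq_oneStepOutput_rpow
    (hv : IsStationaryWeight A (lewisAlpha p) v) (hA : Function.Injective A.mulVec) (hm : 0 < m)
    (hn : 0 < n) (hp : 4 ≤ p) (hε : 0 < ε) (hε1 : ε ≤ 1) (i : Fin m) :
    ApproxEq ε (oneStepOutput A p (totalIterations 72000 m n p ε) i ^ (p / (p - 2)))
      (v i ^ (p / (p - 2))) := by
  have hα0 := lewisAlpha_pos hp
  have hα1 := lewisAlpha_le_one hp
  have h := hv.rowForm_final_mem hA hm hn hp hε hε1 i
  have hw := (oneStepIterate_pos_and_rho_le hA hp (totalIterations 72000 m n p ε)).1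
  have hq := rowForm_nonneg (weightedGram_posDef hA hw) i
  have hp2 : 0 < p - 2 := by linarith
  -- Treating both powers as the single power `p/2` avoids losing accuracy twice: the error is
  -- `p/(p-2) * ε/4 ≤ ε/2`, as `p ≥ 4`.
  have e : 1 / lewisAlpha p * (p / (p - 2)) = p / 2 := by
    rw [lewisAlpha]; field_simp
  rw [hv.eq_rowForm_rpow hα0, oneStepOutput, ← Real.rpow_mul hq,
    ← Real.rpow_mul (rowForm_nonneg hv.posDef i), e]
  refine approxEq_rpow hq (rowForm_nonneg hv.posDef i) (by positivity) (by nlinarith)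
    (by linarith) hε1 ?_ h.1 h.2
  have e2 : p / 2 * (lewisAlpha p * ε / 4) = p / (p - 2) * ε / 4 := by
    rw [lewisAlpha]; field_simp
  have h3 : p / (p - 2) ≤ 2 := by rw [div_le_iff₀ hp2]; linarith
  rw [e2]
  nlinarith

end Accuracy

theorem mainTheorem3 :
    ∃ (c : ℕ) (C : ℝ), 0 < C ∧
      ∀ (m n : ℕ) (A : Matrix (Fin m) (Fin n) ℝ) (p ε : ℝ),
        0 < n → A.rank = n → 4 ≤ p → 0 < ε → ε ≤ 1 →
        -- number of iterations
        (totalIterations c m n p ε : ℝ) ≤ C * (p ^ 3 * Real.log (m * p / ε)) ∧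
        -- the iterates are positive and satisfy the rounding condition
        (∀ k, (∀ i, 0 < oneStepIterate A p k i) ∧
          rhoMax A (lewisAlpha p) (oneStepIterate A p k) ≤ 1 + lewisAlpha p) ∧
        -- the scores used in an iteration are leverage scores of `D A` for a diagonal `D`
        (∀ k i, sigma A (oneStepIterate A p k) i =
          leverageScore (Matrix.diagonal (fun j => √(oneStepIterate A p k j)) * A) i) ∧
        -- the output determines the Lewis weights up to a relative error `ε`
        (∃ u : Fin m → ℝ, IsLewisWeights p A u ∧ (∀ u', IsLewisWeights p A u' → u' = u) ∧
          ∀ i, ApproxEq ε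
            (oneStepOutput A p (totalIterations c m n p ε) i ^ (p / (p - 2))) (u i)) ∧
        -- the output itself approximates the minimizer of the objective
        ((∀ i, A i ≠ 0) →
          (∀ i, 0 < oneStepOutput A p (totalIterations c m n p ε) i) ∧
          ∃ v : Fin m → ℝ, IsObjectiveMinimizer A (lewisAlpha p) v ∧
            (∀ v', IsObjectiveMinimizer A (lewisAlpha p) v' → v' = v) ∧
            ∀ i, ApproxEq ε (oneStepOutput A p (totalIterations c m n p ε) i) (v i)) ∧
        -- the program computes this output, within the stated number of operations
        (oneStepProgram realMachine c (fun i j => A i j) p ε).val =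
          (fun i => oneStepOutput A p (totalIterations c m n p ε) i,
            fun i => oneStepOutput A p (totalIterations c m n p ε) i ^ (p / (p - 2))) ∧
        ((oneStepProgram realMachine c (fun i j => A i j) p ε).time : ℝ) ≤
          C * (p ^ 3 * m * n ^ 2 * Real.log (m * p / ε)) := by
  -- `C = 100 (3c + 2)`: the program costs at most `100 (T + 1) m n²`, and `T + 1 ≤ (3c + 2) p³ log
  -- (m p / ε)`.
  refine ⟨72000, 100 * (3 * (72000 : ℕ) + 2), by positivity, ?_⟩
  intro m n A p ε hn hrank hp hε hε1
  have hA : Function.Injective A.mulVec :=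
    mulVec_injective_of_rank_eq (by rw [hrank, Fintype.card_fin])
  have hmn : n ≤ m := by
    rw [← hrank]
    exact A.rank_le_height
  have hm : 0 < m := hn.trans_le hmn
  have : Nonempty (Fin m) := ⟨⟨0, hm⟩⟩
  have hα0 := lewisAlpha_pos hp
  have hα1 := lewisAlpha_le_one hp
  have hit := oneStepIterate_pos_and_rho_le hA hp
  obtain ⟨v, hv⟩ := exists_isStationaryWeight A hA hα0
  have hT := totalIterations_add_one_le 72000 hm hn hmn hp hε hε1
  have hl := one_le_log_div hm hp hε hε1
  have hX : 0 ≤ p ^ 3 * Real.log (m * p / ε) := mul_nonneg (by positivity) (by linarith)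
  refine ⟨?_, fun k => ⟨(hit k).1, ciSup_le (hit k).2⟩,
    fun k i => sigma_eq_leverageScore A (fun j => ((hit k).1 j).le) i,
    ⟨fun i => v i ^ (p / (p - 2)), hv.isLewisWeights (by linarith),
      fun u hu => hv.eq_of_isLewisWeights hp hu,
      hv.approxEq_oneStepOutput_rpow hA hm hn hp hε hε1⟩,
    fun hrow => ⟨fun i => Real.rpow_pos_of_pos
        (rowForm_pos (weightedGram_posDef hA (hit _).1) (hrow i)) _,
      v, hv.isObjectiveMinimizer hA hα0 hrow,
      fun v' hv' => hv.eq_of_isObjectiveMinimizer hA hα0 hα1 hrow hv',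
      hv.approxEq_oneStepOutput hA hm hn hp hε hε1⟩,
    oneStepProgram_val hA hp _ ε, ?_⟩
  · have h := mul_nonneg (by positivity : (0 : ℝ) ≤ 99 * (3 * (72000 : ℕ) + 2)) hX
    linarith
  · have h1 : ((oneStepProgram realMachine 72000 (fun i j => A i j) p ε).time : ℝ) ≤
        100 * ((totalIterations 72000 m n p ε + 1) * (m * n ^ 2)) := by
      exact_mod_cast oneStepProgram_time_le hn hmn (fun i j => A i j) 72000 p ε
    have h2 := mul_le_mul_of_nonneg_right hT (by positivity : (0 : ℝ) ≤ m * n ^ 2)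
    refine h1.trans ((mul_le_mul_of_nonneg_left h2 (by norm_num)).trans_eq ?_)
    ring
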